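/- \textbf{Weights.} A measurable function $v:(0,\infty)\to(0,\infty)$ is regularly varying of index $\alpha\in\mathbb R$ if $\lim_{t\to\infty}v(tx)/v(t)=x^\alpha$ for every $x>0$. Let $\mathcal W(\mathbb R)$ be the set of all functions $w_*:[0,\infty)\to\mathbb R$ such that: $w_*\in C^\infty(0,\infty)$ is regularly varying of some index $\alpha\in[0,1)$; $w_*\ge 1$; $w_*$ is strictly increasing; $\lim_{t\to\infty}(w_*(t)-M\log t)=\infty$ for every $M\in\mathbb R$; the (one-sided) derivative $w_*'(0)$ exists and equals $0$; and there is $\tau$ such that $w_*''(x)<0$ for all $x>\tau$. \textbf{Modulation spaces.} Fix a window $\rho\in C_0^\infty(\mathbb R^n)$ with values in $[0,1]$, with $\operatorname{supp}\rho\subset[-1,1]^n$ and with $\rho=1$ on $[-\frac12,\frac12]^n$. For $k\in\mathbb Z^n$ put $\sigma_k(\xi)=\rho(\xi-k)\big/\sum_{m\in\mathbb Z^n}\rho(\xi-m)$ and $\Box_k f=\mathcal F^{-1}(\sigma_k\mathcal F f)$ (in the sense of tempered distributions, $\mathcal Ff(\xi)=(2\pi)^{-n/2}\int f(x)e^{-ix\cdot\xi}\,dx$).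 For $1\le p,q\le\infty$ let $\mathcal M^{w_*}_{p,q}(\mathbb R^n)$ be the linear space of all complex-valued $f\in L^p(\mathbb R^n)$ with $$\|f\|_{\mathcal M^{w_*}_{p,q}}=\Big(\sum_{k\in\mathbb Z^n}e^{q\,w_*(|k|)}\,\|\Box_k f\|_{L^p}^q\Big)^{1/q}<\infty ,$$ with the supremum over $k$ of $e^{w_*(|k|)}\|\Box_kf\|_{L^p}$ in place of the sum if $q=\infty$. \textbf{Theorem.} Let $w_*\in\mathcal W(\mathbb R)$ and $1\le q\le\infty$. There is a constant $C>0$, depending only on the window $\rho$, on $n$, $q$ and $w_*$, such that the following hold. (i) Let $1\le p_1,p_2,p\le\infty$ with $\frac1p=\frac1{p_1}+\frac1{p_2}$. If $f\in\mathcal M^{w_*}_{p_1,q}(\mathbb R^n)$ and $g\in\mathcal M^{w_*}_{p_2,q}(\mathbb R^n)$, then $fg\in\mathcal M^{w_*}_{p,q}(\mathbb R^n)$ and $$\|fg\|_{\mathcal M^{w_*}_{p,q}}\le C\,\|f\|_{\mathcal M^{w_*}_{p_1,q}}\,\|g\|_{\mathcal M^{w_*}_{p_2,q}} .$$ (ii)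 For every $1\le p\le\infty$ the space $\mathcal M^{w_*}_{p,q}(\mathbb R^n)$ is an algebra under pointwise multiplication: if $f,g\in\mathcal M^{w_*}_{p,q}(\mathbb R^n)$, then $fg\in\mathcal M^{w_*}_{p,q}(\mathbb R^n)$ and $\|fg\|_{\mathcal M^{w_*}_{p,q}}\le C\,\|f\|_{\mathcal M^{w_*}_{p,q}}\,\|g\|_{\mathcal M^{w_*}_{p,q}}$. Consequently, for every $1\le p\le\infty$ and every entire function $F:\mathbb C\to\mathbb C$ with $F(0)=0$, the superposition operator $f\mapsto F\circ f$ maps $\mathcal M^{w_*}_{p,q}(\mathbb R^n)$ into itself. -/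

import Mathlib

open MeasureTheory Filter Topology
open scoped ENNReal NNReal ContDiff SchwartzMap

noncomputable section

namespace ModSpace

/-- `ℝⁿ` with its Euclidean norm. -/
abbrev E (n : ℕ) : Type := EuclideanSpace ℝ (Fin n)

/-! ### Admissible weights -/

/-- `f : (0,∞) → (0,∞)` is measurable and regularly varying of index `α`
(only the values on `(0,∞)` matter). -/
structure RegularlyVarying (f : ℝ → ℝ) (α : ℝ) : Prop where
  measurable : Measurable ((Set.Ioi (0 : ℝ)).domRestrict f)
  pos : ∀ x : ℝ, 0 < x → 0 < f x
  tendsto : ∀ x : ℝ, 0 < x → Tendsto (fun t : ℝ => f (t * x) / f t) atTop (𝓝 (x ^ α))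

/-- The class `𝒲(ℝ)` of admissible weight functions `w : [0,∞) → ℝ`
(only the values on `[0,∞)` matter; the derivative at `0` is the one-sided one). -/
structure AdmissibleWeight (w : ℝ → ℝ) : Prop where
  smooth : ContDiffOn ℝ ∞ w (Set.Ioi 0)
  regularlyVarying : ∃ α : ℝ, 0 ≤ α ∧ α < 1 ∧ RegularlyVarying w α
  one_le : ∀ x : ℝ, 0 ≤ x → 1 ≤ w x
  strictMono : StrictMonoOn w (Set.Ici 0)
  superlog : ∀ M : ℝ, Tendsto (fun t : ℝ => w t - M * Real.log t) atTop atTop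
  deriv_zero : HasDerivWithinAt w 0 (Set.Ici 0) 0
  concave_end : ∃ τ : ℝ, ∀ x : ℝ, τ < x → deriv (deriv w) x < 0

/-! ### The frequency-uniform decomposition -/

/-- A window: a smooth function `ρ : ℝⁿ → [0,1]` supported in the cube `[-1,1]ⁿ` and equal to `1`
on the cube `[-1/2,1/2]ⁿ`. -/
structure IsWindow {n : ℕ} (ρ : E n → ℝ) : Prop where
  smooth : ContDiff ℝ ∞ ρ
  nonneg : ∀ ξ, 0 ≤ ρ ξ
  le_one : ∀ ξ, ρ ξ ≤ 1
  support : tsupport ρ ⊆ {ξ | ∀ i, |ξ i| ≤ 1}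
  eq_one : ∀ ξ : E n, (∀ i, |ξ i| ≤ 1 / 2) → ρ ξ = 1

/-- The point `k ∈ ℤⁿ` seen in `ℝⁿ`. -/
def lattice {n : ℕ} (k : Fin n → ℤ) : E n := WithLp.toLp 2 (fun i => (k i : ℝ))

/-- `σ_k(ξ) = ρ(ξ - k) / ∑_m ρ(ξ - m)`. For a window `ρ` the sum over `m ∈ ℤⁿ` has, at each `ξ`,
only finitely many nonzero terms, and it is at least `1`. -/
def sigma {n : ℕ} (ρ : E n → ℝ) (k : Fin n → ℤ) (ξ : E n) : ℝ :=
  ρ (ξ - lattice k) / ∑' m : Fin n → ℤ, ρ (ξ - lattice m)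

/-- The uniform decomposition operator `□_k u = ℱ⁻¹(σ_k ℱ u)` on tempered distributions, where
`ℱ u(ξ) = (2π)^(-n/2) ∫ u(x) exp(-i x·ξ) dx`. Mathlib's Fourier transform has the kernel
`exp(-2πi x·ξ)`, so that in its normalization the symbol is `ξ ↦ σ_k(2πξ)`. -/
def box {n : ℕ} (ρ : E n → ℝ) (k : Fin n → ℤ) : 𝓢'(E n, ℂ) →L[ℂ] 𝓢'(E n, ℂ) :=
  TemperedDistribution.fourierMultiplierCLM ℂ
    (fun ξ : E n => ((sigma ρ k ((2 * Real.pi) • ξ) : ℝ) : ℂ))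

/-! ### Modulation spaces -/

/-- The `L^p` norm of a tempered distribution: the norm of the (unique) `L^p` function which
represents it, and `∞` if there is none. -/
def distENorm {n : ℕ} (p : ℝ≥0∞) [Fact (1 ≤ p)] (u : 𝓢'(E n, ℂ)) : ℝ≥0∞ :=
  ⨅ (g : Lp ℂ p (volume : Measure (E n))) (_ : Lp.toTemperedDistribution g = u), ‖g‖ₑ

/-- The `ℓ^q` norm of a family with values in `[0,∞]`. -/
def lqENorm {ι : Type*} (q : ℝ≥0∞) (a : ι → ℝ≥0∞) : ℝ≥0∞ :=
  if q = ⊤ then ⨆ k, a k else (∑' k, a k ^ q.toReal) ^ (1 / q.toReal)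

/-- The modulation space norm
`‖f‖ = (∑_k exp(q w(|k|)) ‖□_k f‖_{L^p}^q)^(1/q)`, with values in `[0,∞]`. -/
def modENorm {n : ℕ} (ρ : E n → ℝ) (w : ℝ → ℝ) (p q : ℝ≥0∞) [Fact (1 ≤ p)]
    (f : Lp ℂ p (volume : Measure (E n))) : ℝ≥0∞ :=
  lqENorm q fun k : Fin n → ℤ =>
    ENNReal.ofReal (Real.exp (w ‖lattice k‖)) *
      distENorm p (box ρ k (Lp.toTemperedDistribution f))

theorem distENorm_add_le {n : ℕ} (p : ℝ≥0∞) [Fact (1 ≤ p)] (u v : 𝓢'(E n, ℂ)) :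
    distENorm p (u + v) ≤ distENorm p u + distENorm p v := by
  unfold distENorm
  refine ENNReal.le_iInf₂_add_iInf₂ fun g hg g' hg' => ?_
  refine (iInf₂_le (g + g') ?_).trans (enorm_add_le g g')
  rw [← hg, ← hg']
  exact map_add (Lp.toTemperedDistributionCLM ℂ (volume : Measure (E n)) p) g g'

theorem distENorm_smul_le {n : ℕ} (p : ℝ≥0∞) [Fact (1 ≤ p)] (c : ℂ) (u : 𝓢'(E n, ℂ)) :
    distENorm p (c • u) ≤ ‖c‖ₑ * distENorm p u := by
  by_cases hc : c = 0
  · subst hc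
    refine (iInf₂_le (0 : Lp ℂ p (volume : Measure (E n))) ?_).trans (by simp)
    have h := map_zero (Lp.toTemperedDistributionCLM ℂ (volume : Measure (E n)) p)
    rw [Lp.toTemperedDistributionCLM_apply] at h
    rw [h]
    ext φ
    simp
  · unfold distENorm
    rw [ENNReal.mul_iInf_of_ne (by simpa using hc) enorm_ne_top]
    refine le_iInf fun g => ?_
    rw [ENNReal.mul_iInf_of_ne (by simpa using hc) enorm_ne_top]
    refine le_iInf fun hg => ?_
    refine (iInf₂_le (c • g) ?_).trans (enorm_smul c g).le
    rw [← hg]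
    exact map_smul (Lp.toTemperedDistributionCLM ℂ (volume : Measure (E n)) p) c g

theorem lqENorm_mono {ι : Type*} {q : ℝ≥0∞} {a b : ι → ℝ≥0∞} (h : ∀ k, a k ≤ b k) :
    lqENorm q a ≤ lqENorm q b := by
  unfold lqENorm
  split_ifs
  · exact iSup_mono h
  · gcongr with k
    exact h k

theorem lqENorm_add_le {ι : Type*} {q : ℝ≥0∞} (hq : 1 ≤ q) (a b : ι → ℝ≥0∞) :
    lqENorm q (fun k => a k + b k) ≤ lqENorm q a + lqENorm q b := by
  unfold lqENorm
  split_ifs with h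
  · exact iSup_le fun k => add_le_add (le_iSup a k) (le_iSup b k)
  · let _ : MeasurableSpace ι := ⊤
    have h1 : 1 ≤ q.toReal := by
      rw [← ENNReal.toReal_one]
      exact ENNReal.toReal_mono h hq
    have := ENNReal.lintegral_Lp_add_le (μ := Measure.count) (f := a) (g := b)
      (Measurable.of_discrete).aemeasurable (Measurable.of_discrete).aemeasurable h1
    simpa only [lintegral_count, Pi.add_apply] using this

theorem lqENorm_const_mul {ι : Type*} {q : ℝ≥0∞} (hq : 1 ≤ q) (c : ℝ≥0∞) (a : ι → ℝ≥0∞) :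
    lqENorm q (fun k => c * a k) = c * lqENorm q a := by
  unfold lqENorm
  split_ifs with h
  · rw [ENNReal.mul_iSup]
  · have h1 : 0 < q.toReal := ENNReal.toReal_pos (zero_lt_one.trans_le hq).ne' h
    simp_rw [ENNReal.mul_rpow_of_nonneg _ _ h1.le]
    rw [ENNReal.tsum_mul_left, ENNReal.mul_rpow_of_nonneg _ _ (by positivity),
      ← ENNReal.rpow_mul, mul_one_div_cancel h1.ne', ENNReal.rpow_one]

theorem modENorm_add_le {n : ℕ} (ρ : E n → ℝ) (w : ℝ → ℝ) (p q : ℝ≥0∞) [Fact (1 ≤ p)]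
    (hq : 1 ≤ q) (f g : Lp ℂ p (volume : Measure (E n))) :
    modENorm ρ w p q (f + g) ≤ modENorm ρ w p q f + modENorm ρ w p q g := by
  refine (lqENorm_mono fun k => ?_).trans (lqENorm_add_le hq _ _)
  rw [← mul_add]
  gcongr
  have h := map_add (Lp.toTemperedDistributionCLM ℂ (volume : Measure (E n)) p) f g
  simp only [Lp.toTemperedDistributionCLM_apply] at h
  rw [h, map_add]
  exact distENorm_add_le p _ _

theorem modENorm_smul_le {n : ℕ} (ρ : E n → ℝ) (w : ℝ → ℝ) (p q : ℝ≥0∞) [Fact (1 ≤ p)]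
    (hq : 1 ≤ q) (c : ℂ) (f : Lp ℂ p (volume : Measure (E n))) :
    modENorm ρ w p q (c • f) ≤ ‖c‖ₑ * modENorm ρ w p q f := by
  unfold modENorm
  rw [← lqENorm_const_mul hq]
  refine lqENorm_mono fun k => ?_
  rw [mul_left_comm]
  gcongr
  have h := map_smul (Lp.toTemperedDistributionCLM ℂ (volume : Measure (E n)) p) c f
  simp only [Lp.toTemperedDistributionCLM_apply] at h
  rw [h, map_smul]
  exact distENorm_smul_le p _ _

/-- The modulation space `ℳ^w_{p,q}(ℝⁿ)`: the linear space of all `f ∈ L^p(ℝⁿ)` of finite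
modulation space norm. -/
def modulationSpace {n : ℕ} (ρ : E n → ℝ) (w : ℝ → ℝ) (p q : ℝ≥0∞) [Fact (1 ≤ p)]
    [hq : Fact (1 ≤ q)] : Submodule ℂ (Lp ℂ p (volume : Measure (E n))) where
  carrier := {f | modENorm ρ w p q f < ⊤}
  add_mem' {f g} hf hg :=
    (modENorm_add_le ρ w p q hq.out f g).trans_lt (ENNReal.add_lt_top.2 ⟨hf, hg⟩)
  zero_mem' := by
    have h := modENorm_smul_le ρ w p q hq.out 0 (0 : Lp ℂ p (volume : Measure (E n)))
    rw [zero_smul, enorm_zero, zero_mul] at h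
    exact h.trans_lt ENNReal.zero_lt_top
  smul_mem' c f hf :=
    (modENorm_smul_le ρ w p q hq.out c f).trans_lt (ENNReal.mul_lt_top enorm_lt_top hf)

end ModSpace

end

noncomputable section

namespace ModSpace

/-! ### Convolution inequalities -/

/-! Decompose `f` and `g` into frequency pieces. The product `□_l f □_m g` has spectrum near `l +
m`, so `□_k` kills it unless `k - l - m` lies in a fixed finite set (`IsWindow.box_mul_eq_zero`).
Hölder then bounds `‖□_k(fg)‖_p` by a discrete convolution of `‖□_l f‖_{p₁}` and `‖□_m g‖_{p₂}`
(`IsWindow.enorm_boxLp_holderL_le`). What remains is that the weighted space `ℓ^q` is a convolution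
algebra (`AdmissibleWeight.exists_lqENorm_le`).

The weight enters there. Eventual concavity and regular variation of index below `1` give `w(x+y) ≤
w(x) + c w(y) + K` for `y ≤ x` with some `c < 1`. Hence `e^{w(|k|)}` is at most a constant times
`e^{w(|l|)} e^{w(|m|)} (e^{-δw(|l|)} + e^{-δw(|m|)})`. Since `w` beats every multiple of the
logarithm, the factors `e^{-δw}` are summable over the lattice: they turn one `ℓ^q` sequence into an
`ℓ^1` sequence, and Young's inequality applies.

Summability of `e^{-w}` also makes `∑ □_k f` absolutely convergent in `L^p`, even for `p = ∞`;
`IsWindow.hasSum_boxLp` identifies the sum with `f`. For (ii), Bernstein's inequality embeds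
`ℳ_{p,q}` into `ℳ_{∞,q}`, and (i) is used with exponents `p, ∞, p`. The algebra bound makes the
norms of powers of `f` grow at most geometrically, so the power series of an entire function
converges in the space. -/

/-- Hölder's inequality for the splitting `u b = u^{1-1/r} (u b^r)^{1/r}`. -/
theorem lintegral_mul_rpow_le {α : Type*} [MeasurableSpace α] {μ : Measure α} {u b : α → ℝ≥0∞}
    (hu : AEMeasurable u μ) (hb : AEMeasurable b μ) {r : ℝ} (hr : 1 ≤ r) :
    (∫⁻ y, u y * b y ∂μ) ^ r ≤ (∫⁻ y, u y ∂μ) ^ (r - 1) * ∫⁻ y, u y * b y ^ r ∂μ := by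
  have hr0 : 0 < r := by linarith
  have h1 : (0 : ℝ) ≤ 1 - 1 / r := by
    rw [sub_nonneg, div_le_one hr0]; exact hr
  have key := ENNReal.lintegral_mul_norm_pow_le (μ := μ) hu (hu.mul (hb.pow_const r)) h1
    (q := 1 / r) (by positivity) (by ring)
  have e : ∀ y, u y ^ (1 - 1 / r) * (u y * b y ^ r) ^ (1 / r) = u y * b y := fun y => by
    rw [ENNReal.mul_rpow_of_nonneg _ _ (by positivity), ← ENNReal.rpow_mul,
      mul_one_div_cancel hr0.ne',
      ENNReal.rpow_one, ← mul_assoc, ← ENNReal.rpow_add_of_nonneg _ _ h1 (by positivity)]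
    simp
  simp only [Pi.mul_apply, e] at key
  calc _ ≤ ((∫⁻ y, u y ∂μ) ^ (1 - 1 / r) * (∫⁻ y, u y * b y ^ r ∂μ) ^ (1 / r)) ^ r := by
        gcongr
    _ = _ := by
        rw [ENNReal.mul_rpow_of_nonneg _ _ hr0.le, ← ENNReal.rpow_mul, ← ENNReal.rpow_mul,
          one_div_mul_cancel hr0.ne', ENNReal.rpow_one]
        congr 2
        field_simp

/-- Young's inequality `‖u * b‖_r ≤ ‖u‖_1 ‖b‖_r`. -/
theorem lintegral_convolution_rpow_le {G : Type*} [AddCommGroup G] [MeasurableSpace G]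
    [MeasurableAdd₂ G] [MeasurableNeg G] [MeasurableSub₂ G] {μ : Measure G} [SFinite μ]
    [μ.IsAddLeftInvariant] {u b : G → ℝ≥0∞}
    (hu : Measurable u) (hb : Measurable b) {r : ℝ} (hr : 1 ≤ r) :
    ∫⁻ x, (∫⁻ y, u y * b (x - y) ∂μ) ^ r ∂μ ≤ (∫⁻ y, u y ∂μ) ^ r * ∫⁻ y, b y ^ r ∂μ := by
  calc ∫⁻ x, (∫⁻ y, u y * b (x - y) ∂μ) ^ r ∂μ
      ≤ ∫⁻ x, (∫⁻ y, u y ∂μ) ^ (r - 1) * ∫⁻ y, u y * b (x - y) ^ r ∂μ ∂μ := by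
        gcongr with x
        exact lintegral_mul_rpow_le hu.aemeasurable
          (hb.comp (measurable_const.sub measurable_id)).aemeasurable hr
    _ = (∫⁻ y, u y ∂μ) ^ (r - 1) * ∫⁻ x, ∫⁻ y, u y * b (x - y) ^ r ∂μ ∂μ := by
        rw [lintegral_const_mul]
        refine Measurable.lintegral_prod_right' (f := fun z : G × G => u z.2 * b (z.1 - z.2) ^ r) ?_
        fun_prop
    _ = (∫⁻ y, u y ∂μ) ^ (r - 1) * ∫⁻ y, u y * ∫⁻ x, b (x - y) ^ r ∂μ ∂μ := by
        rw [lintegral_lintegral_swap]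
        · congr 1
          refine lintegral_congr fun y => ?_
          rw [lintegral_const_mul]
          fun_prop
        · fun_prop
    _ = (∫⁻ y, u y ∂μ) ^ (r - 1) * ((∫⁻ y, u y ∂μ) * ∫⁻ y, b y ^ r ∂μ) := by
        simp_rw [fun y => lintegral_sub_right_eq_self (μ := μ) (fun x => b x ^ r) y]
        rw [lintegral_mul_const _ hu]
    _ = _ := by
        rw [← mul_assoc]
        congr 1
        nth_rw 2 [← ENNReal.rpow_one (∫⁻ y, u y ∂μ)]
        rw [← ENNReal.rpow_add_of_nonneg _ _ (by linarith) zero_le_one]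
        simp

/-! ### Families with values in `[0,∞]` -/

theorem le_lqENorm {ι : Type*} {q : ℝ≥0∞} (hq : 1 ≤ q) (a : ι → ℝ≥0∞) (k : ι) :
    a k ≤ lqENorm q a := by
  unfold lqENorm
  split_ifs with h
  · exact le_iSup a k
  · have h1 : 0 < q.toReal := ENNReal.toReal_pos (zero_lt_one.trans_le hq).ne' h
    calc a k = (a k ^ q.toReal) ^ (1 / q.toReal) := by
          rw [← ENNReal.rpow_mul, mul_one_div_cancel h1.ne', ENNReal.rpow_one]
      _ ≤ _ := by
          gcongr
          exact ENNReal.le_tsum k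

theorem lqENorm_comp_equiv {ι κ : Type*} {q : ℝ≥0∞} (a : ι → ℝ≥0∞) (e : κ ≃ ι) :
    lqENorm q (fun k => a (e k)) = lqENorm q a := by
  unfold lqENorm
  split_ifs with h
  · exact e.iSup_comp (g := a)
  · rw [e.tsum_eq (fun k => a k ^ q.toReal)]

theorem lqENorm_zero {ι : Type*} {q : ℝ≥0∞} (hq : 1 ≤ q) : lqENorm q (fun _ : ι => 0) = 0 := by
  simpa using lqENorm_const_mul hq 0 (fun _ : ι => (0 : ℝ≥0∞))

theorem lqENorm_sum_le {ι κ : Type*} {q : ℝ≥0∞} (hq : 1 ≤ q) (s : Finset κ) (a : κ → ι → ℝ≥0∞) :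
    lqENorm q (fun k => ∑ j ∈ s, a j k) ≤ ∑ j ∈ s, lqENorm q (a j) := by
  classical
  induction s using Finset.induction_on with
  | empty => simp [lqENorm_zero hq]
  | insert j s hj ih =>
    simp only [Finset.sum_insert hj]
    exact (lqENorm_add_le hq _ _).trans (by gcongr)

/-- Fatou's lemma for `ℓ^q` norms. -/
theorem lqENorm_le_of_tendsto {ι : Type*} {q : ℝ≥0∞} (hq : 1 ≤ q) {a : ℕ → ι → ℝ≥0∞}
    {b : ι → ℝ≥0∞} (h : ∀ k, Tendsto (fun N => a N k) atTop (𝓝 (b k))) {B : ℝ≥0∞}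
    (hB : ∀ N, lqENorm q (a N) ≤ B) : lqENorm q b ≤ B := by
  unfold lqENorm at hB ⊢
  split_ifs at hB ⊢ with hq'
  · exact iSup_le fun k => le_of_tendsto' (h k) fun N => (le_iSup (a N) k).trans (hB N)
  · have h1 : 0 < q.toReal := ENNReal.toReal_pos (zero_lt_one.trans_le hq).ne' hq'
    rw [one_div, ENNReal.rpow_inv_le_iff h1, ENNReal.tsum_eq_iSup_sum]
    refine iSup_le fun s => ?_
    refine le_of_tendsto' (tendsto_finsetSum s fun k _ =>
      (ENNReal.continuous_rpow_const.tendsto _).comp (h k)) fun N => ?_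
    refine (ENNReal.sum_le_tsum s).trans ?_
    have := hB N
    rwa [one_div, ENNReal.rpow_inv_le_iff h1] at this

/-- Finite Minkowski passes to the limit of the partial sums by Fatou. -/
theorem lqENorm_tsum_le {ι : Type*} {q : ℝ≥0∞} (hq : 1 ≤ q) (a : ℕ → ι → ℝ≥0∞) :
    lqENorm q (fun k => ∑' j, a j k) ≤ ∑' j, lqENorm q (a j) :=
  lqENorm_le_of_tendsto hq (fun _ => ENNReal.tendsto_nat_tsum _) fun N =>
    (lqENorm_sum_le hq (Finset.range N) a).trans (ENNReal.sum_le_tsum _)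

theorem lqENorm_convolution_le {n : ℕ} {q : ℝ≥0∞} (hq : 1 ≤ q) (u b : (Fin n → ℤ) → ℝ≥0∞) :
    lqENorm q (fun k => ∑' l, u l * b (k - l)) ≤ (∑' l, u l) * lqENorm q b := by
  unfold lqENorm
  split_ifs with h
  · refine iSup_le fun k => ?_
    rw [← ENNReal.tsum_mul_right]
    refine ENNReal.tsum_le_tsum fun l => ?_
    gcongr
    exact le_iSup b _
  · have h1 : 1 ≤ q.toReal := by
      rw [← ENNReal.toReal_one]
      exact ENNReal.toReal_mono h hq
    have h0 : 0 < q.toReal := by linarith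
    have := lintegral_convolution_rpow_le (G := Fin n → ℤ) (μ := Measure.count)
      (u := u) (b := b) (measurable_of_countable _) (measurable_of_countable _) h1
    simp only [lintegral_count] at this
    calc _ ≤ ((∑' l, u l) ^ q.toReal * ∑' k, b k ^ q.toReal) ^ (1 / q.toReal) := by gcongr
      _ = _ := by
        rw [ENNReal.mul_rpow_of_nonneg _ _ (by positivity), ← ENNReal.rpow_mul,
          mul_one_div_cancel h0.ne', ENNReal.rpow_one]

/-! ### Convolution of `L^p` functions with Schwartz functions -/

section Convolution

variable {n : ℕ}

/-- The convolution `κ * f`. -/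
def conv (κ : 𝓢(E n, ℂ)) (f : E n → ℂ) (x : E n) : ℂ := ∫ y, κ (x - y) * f y

/-- The larger one of the `L^1` and the sup norm. -/
def kernelNorm (κ : 𝓢(E n, ℂ)) : ℝ≥0∞ := max (∫⁻ y, ‖κ y‖ₑ) (⨆ y, ‖κ y‖ₑ)

theorem kernelNorm_lt_top (κ : 𝓢(E n, ℂ)) : kernelNorm κ < ⊤ := by
  refine max_lt κ.integrable.2 ?_
  refine lt_of_le_of_lt (iSup_le fun y => ?_)
    (ENNReal.ofReal_lt_top (r := SchwartzMap.seminorm ℝ 0 0 κ))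
  rw [← ofReal_norm]
  exact ENNReal.ofReal_le_ofReal (SchwartzMap.norm_le_seminorm ℝ κ y)

theorem lintegral_enorm_sub_left (κ : E n → ℂ) (x : E n) :
    ∫⁻ y, ‖κ (x - y)‖ₑ = ∫⁻ y, ‖κ y‖ₑ :=
  lintegral_sub_left_eq_self (μ := (volume : Measure (E n))) (fun y => ‖κ y‖ₑ) x

theorem ae_enorm_le_eLpNorm_top {f : E n → ℂ} : ∀ᵐ y, ‖f y‖ₑ ≤ eLpNorm f ⊤ volume := by
  rw [eLpNorm_exponent_top]
  exact ae_le_eLpNormEssSup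

/-- `∫ |κ(x - y)| |f(y)| dy ≤ max(‖κ‖₁, ‖κ‖_∞) ‖f‖_p`. -/
theorem lintegral_enorm_mul_le (κ : 𝓢(E n, ℂ)) {p : ℝ≥0∞} (hp : 1 ≤ p) {f : E n → ℂ}
    (hf : AEStronglyMeasurable f volume) (x : E n) :
    ∫⁻ y, ‖κ (x - y)‖ₑ * ‖f y‖ₑ ≤ kernelNorm κ * eLpNorm f p volume := by
  have hκ : Measurable fun y => ‖κ (x - y)‖ₑ :=
    (κ.continuous.comp (continuous_const.sub continuous_id)).enorm.measurable
  by_cases hp' : p = ⊤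
  · subst hp'
    calc ∫⁻ y, ‖κ (x - y)‖ₑ * ‖f y‖ₑ ≤ ∫⁻ y, ‖κ (x - y)‖ₑ * eLpNorm f ⊤ volume := by
          refine lintegral_mono_ae ?_
          filter_upwards [ae_enorm_le_eLpNorm_top (f := f)] with y hy
          gcongr
      _ = (∫⁻ y, ‖κ y‖ₑ) * eLpNorm f ⊤ volume := by
          rw [lintegral_mul_const _ hκ, lintegral_enorm_sub_left]
      _ ≤ _ := by
          gcongr
          exact le_max_left _ _
  · have h1 : 1 ≤ p.toReal := by
      rw [← ENNReal.toReal_one]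
      exact ENNReal.toReal_mono hp' hp
    have h0 : 0 < p.toReal := by linarith
    have key := lintegral_mul_rpow_le (μ := volume) hκ.aemeasurable hf.enorm h1
    rw [eLpNorm_eq_lintegral_rpow_enorm_toReal (zero_lt_one.trans_le hp).ne' hp']
    rw [← ENNReal.rpow_le_rpow_iff h0, ENNReal.mul_rpow_of_nonneg _ _ h0.le, ← ENNReal.rpow_mul,
      one_div_mul_cancel h0.ne', ENNReal.rpow_one]
    refine key.trans ?_
    -- The `L^1` norm of the kernel controls the power `p - 1` and its sup norm the remaining
    -- factor, so no conjugate exponent is needed.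
    calc _ ≤ kernelNorm κ ^ (p.toReal - 1) * ∫⁻ y, kernelNorm κ * ‖f y‖ₑ ^ p.toReal := by
          rw [lintegral_enorm_sub_left]
          gcongr with y
          · exact le_max_left _ _
          · exact (le_iSup (fun y => ‖κ y‖ₑ) (x - y)).trans (le_max_right _ _)
      _ = _ := by
          rw [lintegral_const_mul'' _ (hf.enorm.pow_const _), ← mul_assoc]
          congr 1
          nth_rw 2 [← ENNReal.rpow_one (kernelNorm κ)]
          rw [← ENNReal.rpow_add_of_nonneg _ _ (by linarith) zero_le_one]
          simp

theorem enorm_conv_le_lintegral (κ : 𝓢(E n, ℂ)) (f : E n → ℂ) (x : E n) :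
    ‖conv κ f x‖ₑ ≤ ∫⁻ y, ‖κ (x - y)‖ₑ * ‖f y‖ₑ :=
  (enorm_integral_le_lintegral_enorm _).trans (by simp only [enorm_mul, le_refl])

theorem enorm_conv_le (κ : 𝓢(E n, ℂ)) {p : ℝ≥0∞} (hp : 1 ≤ p) {f : E n → ℂ}
    (hf : AEStronglyMeasurable f volume) (x : E n) :
    ‖conv κ f x‖ₑ ≤ kernelNorm κ * eLpNorm f p volume :=
  (enorm_conv_le_lintegral κ f x).trans (lintegral_enorm_mul_le κ hp hf x)

theorem conv_congr_ae (κ : 𝓢(E n, ℂ)) {f g : E n → ℂ} (h : f =ᵐ[volume] g) :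
    conv κ f = conv κ g := by
  ext x
  refine integral_congr_ae ?_
  filter_upwards [h] with y hy
  rw [hy]

theorem stronglyMeasurable_conv (κ : 𝓢(E n, ℂ)) {f : E n → ℂ}
    (hf : AEStronglyMeasurable f volume) : StronglyMeasurable (conv κ f) := by
  rw [conv_congr_ae κ hf.ae_eq_mk]
  refine StronglyMeasurable.integral_prod_right (f := fun x y => κ (x - y) * hf.mk f y) ?_
  refine StronglyMeasurable.mul ?_ (hf.stronglyMeasurable_mk.comp_measurable measurable_snd)
  exact (κ.continuous.comp (continuous_fst.sub continuous_snd)).stronglyMeasurable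

theorem eLpNorm_conv_le (κ : 𝓢(E n, ℂ)) {p : ℝ≥0∞} (hp : 1 ≤ p) {f : E n → ℂ}
    (hf : AEStronglyMeasurable f volume) :
    eLpNorm (conv κ f) p volume ≤ kernelNorm κ * eLpNorm f p volume := by
  by_cases hp' : p = ⊤
  · subst hp'
    rw [eLpNorm_exponent_top]
    exact essSup_le_of_ae_le _ (Eventually.of_forall fun x => enorm_conv_le κ hp hf x)
  · have h1 : 1 ≤ p.toReal := by
      rw [← ENNReal.toReal_one]
      exact ENNReal.toReal_mono hp' hp
    have h0 : 0 < p.toReal := by linarith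
    have hκ : Measurable fun y => ‖κ y‖ₑ := κ.continuous.enorm.measurable
    have key := lintegral_convolution_rpow_le (μ := (volume : Measure (E n))) hκ
      hf.stronglyMeasurable_mk.enorm h1
    rw [eLpNorm_congr_ae hf.ae_eq_mk, conv_congr_ae κ hf.ae_eq_mk,
      eLpNorm_eq_lintegral_rpow_enorm_toReal (zero_lt_one.trans_le hp).ne' hp',
      eLpNorm_eq_lintegral_rpow_enorm_toReal (zero_lt_one.trans_le hp).ne' hp',
      ← ENNReal.rpow_le_rpow_iff h0, ENNReal.mul_rpow_of_nonneg _ _ h0.le, ← ENNReal.rpow_mul,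
      one_div_mul_cancel h0.ne', ENNReal.rpow_one, ← ENNReal.rpow_mul,
      one_div_mul_cancel h0.ne', ENNReal.rpow_one]
    calc ∫⁻ x, ‖conv κ (hf.mk f) x‖ₑ ^ p.toReal
        ≤ ∫⁻ x, (∫⁻ y, ‖κ y‖ₑ * ‖hf.mk f (x - y)‖ₑ) ^ p.toReal := by
          gcongr with x
          refine (enorm_conv_le_lintegral κ _ x).trans_eq ?_
          rw [← lintegral_sub_left_eq_self _ x]
          simp only [sub_sub_cancel]
      _ ≤ _ := key
      _ ≤ _ := by
          gcongr
          exact le_max_left _ _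

theorem memLp_conv (κ : 𝓢(E n, ℂ)) {p : ℝ≥0∞} (hp : 1 ≤ p) {f : E n → ℂ} (hf : MemLp f p volume) :
    MemLp (conv κ f) p volume :=
  ⟨(stronglyMeasurable_conv κ hf.1).aestronglyMeasurable,
    (eLpNorm_conv_le κ hp hf.1).trans_lt (ENNReal.mul_lt_top (kernelNorm_lt_top κ) hf.2)⟩

theorem eLpNorm_top_conv_le (κ : 𝓢(E n, ℂ)) {p : ℝ≥0∞} (hp : 1 ≤ p) {f : E n → ℂ}
    (hf : AEStronglyMeasurable f volume) :
    eLpNorm (conv κ f) ⊤ volume ≤ kernelNorm κ * eLpNorm f p volume := by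
  rw [eLpNorm_exponent_top]
  exact essSup_le_of_ae_le _ (Eventually.of_forall fun x => enorm_conv_le κ hp hf x)

theorem memLp_top_conv (κ : 𝓢(E n, ℂ)) {p : ℝ≥0∞} (hp : 1 ≤ p) {f : E n → ℂ}
    (hf : MemLp f p volume) : MemLp (conv κ f) ⊤ volume :=
  ⟨(stronglyMeasurable_conv κ hf.1).aestronglyMeasurable,
    (eLpNorm_top_conv_le κ hp hf.1).trans_lt (ENNReal.mul_lt_top (kernelNorm_lt_top κ) hf.2)⟩

/-- Convolution with `κ` is, for the bilinear pairing, the transpose of convolution with the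
reflected kernel. -/
theorem integral_mul_conv (κ : 𝓢(E n, ℂ)) {p : ℝ≥0∞} (hp : 1 ≤ p) {f h : E n → ℂ}
    (hf : MemLp f p volume) (hh : Integrable h) :
    ∫ x, h x * conv κ f x = ∫ y, f y * ∫ x, κ (x - y) * h x := by
  have hκm : AEStronglyMeasurable (fun z : E n × E n => κ (z.1 - z.2))
      ((volume : Measure (E n)).prod volume) :=
    (κ.continuous.comp (continuous_fst.sub continuous_snd)).aestronglyMeasurable
  have hm : AEStronglyMeasurable (fun z : E n × E n => h z.1 * (κ (z.1 - z.2) * f z.2))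
      ((volume : Measure (E n)).prod volume) :=
    hh.1.comp_fst.mul (hκm.mul hf.1.comp_snd)
  have hint : Integrable (fun z : E n × E n => h z.1 * (κ (z.1 - z.2) * f z.2))
      ((volume : Measure (E n)).prod volume) := by
    refine ⟨hm, ?_⟩
    unfold HasFiniteIntegral
    rw [lintegral_prod _ hm.enorm]
    calc ∫⁻ x, ∫⁻ y, ‖h x * (κ (x - y) * f y)‖ₑ
        ≤ ∫⁻ x, ‖h x‖ₑ * (kernelNorm κ * eLpNorm f p volume) := by
          gcongr with x
          simp_rw [enorm_mul]
          rw [lintegral_const_mul' _ _ enorm_ne_top]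
          gcongr
          exact lintegral_enorm_mul_le κ hp hf.1 x
      _ = (∫⁻ x, ‖h x‖ₑ) * (kernelNorm κ * eLpNorm f p volume) :=
          lintegral_mul_const'' _ hh.1.enorm
      _ < ⊤ := ENNReal.mul_lt_top hh.2 (ENNReal.mul_lt_top (kernelNorm_lt_top κ) hf.2)
  calc ∫ x, h x * conv κ f x = ∫ x, ∫ y, h x * (κ (x - y) * f y) := by
        simp only [conv, integral_const_mul]
    _ = ∫ y, ∫ x, h x * (κ (x - y) * f y) := integral_integral_swap hint
    _ = _ := by
        refine integral_congr_ae (Eventually.of_forall fun y => ?_)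
        simp only
        rw [← integral_const_mul]
        refine integral_congr_ae (Eventually.of_forall fun x => ?_)
        ring

end Convolution

/-! ### Fourier multipliers with Schwartz symbols, and the spectrum of a product -/

section Multiplier

open FourierTransform

variable {n : ℕ}

theorem fourierInv_apply_eq_fourier_neg (f : 𝓢(E n, ℂ)) (x : E n) : (𝓕⁻ f) x = 𝓕 f (-x) := by
  rw [SchwartzMap.fourierInv_coe, Real.fourierInv_eq_fourier_neg]
  rfl

theorem fourier_compSubConstCLM (κ : 𝓢(E n, ℂ)) (y ξ : E n) :
    𝓕 (SchwartzMap.compSubConstCLM ℂ y κ) ξ = Real.fourierChar (-inner ℝ y ξ) • 𝓕 κ ξ := by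
  rw [SchwartzMap.fourier_coe, SchwartzMap.fourier_coe, Real.fourier_eq, Real.fourier_eq,
    ← integral_add_right_eq_self _ y, Circle.smul_def, ← integral_smul]
  refine integral_congr_ae (Eventually.of_forall fun v => ?_)
  simp only [SchwartzMap.compSubConstCLM_apply, add_sub_cancel_right, Circle.smul_def,
    inner_add_left, neg_add, AddChar.map_add_eq_mul, Circle.coe_mul, smul_eq_mul]
  ring

/-- The transpose of the multiplier, acting on test functions, is correlation with the kernel `𝓕⁻
S`: apply the multiplication formula and note that translating the kernel multiplies `S` by a
character. -/
theorem fourier_smulLeftCLM_fourierInv_apply (S φ : 𝓢(E n, ℂ)) (y : E n) :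
    𝓕 (SchwartzMap.smulLeftCLM ℂ S (𝓕⁻ φ)) y = ∫ x, (𝓕⁻ S) (x - y) * φ x := by
  have h1 : ∫ x, (𝓕⁻ S) (x - y) * φ x
      = ∫ ξ, 𝓕 (SchwartzMap.compSubConstCLM ℂ y (𝓕⁻ S)) ξ * (𝓕⁻ φ) ξ := by
    rw [SchwartzMap.integral_fourier_mul_eq]
    simp
  rw [h1, SchwartzMap.fourier_coe, Real.fourier_eq]
  refine integral_congr_ae (Eventually.of_forall fun ξ => ?_)
  simp only [fourier_compSubConstCLM, fourier_fourierInv_eq,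
    SchwartzMap.smulLeftCLM_apply_apply S.hasTemperateGrowth, Circle.smul_def, smul_eq_mul,
    real_inner_comm]
  ring

/-- This ties the distributional multiplier to an honest convolution. Working by duality covers `p =
∞`, where Schwartz functions are not dense. -/
theorem fourierMultiplierCLM_toTemperedDistribution (S : 𝓢(E n, ℂ)) {p : ℝ≥0∞} [hp : Fact (1 ≤ p)]
    (f : Lp ℂ p (volume : Measure (E n))) (φ : 𝓢(E n, ℂ)) :
    TemperedDistribution.fourierMultiplierCLM ℂ S (Lp.toTemperedDistribution f) φ =
      ∫ x, φ x * conv (𝓕⁻ S) f x := by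
  rw [TemperedDistribution.fourierMultiplierCLM_apply_apply, Lp.toTemperedDistribution_apply,
    integral_mul_conv _ hp.out (Lp.memLp f) φ.integrable]
  refine integral_congr_ae (Eventually.of_forall fun y => ?_)
  simp only [fourier_smulLeftCLM_fourierInv_apply, smul_eq_mul]
  ring

/-- Write `A D` as the Fourier transform of `𝓕⁻ A * 𝓕⁻ D` and move the transform onto `𝓕 χ`. This
pairs a reflected `χ` with the convolution, and the hypothesis makes the integrand of the resulting
double integral vanish. -/
theorem integral_mul_mul_fourier_eq_zero {A D χ : 𝓢(E n, ℂ)}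
    (h : ∀ a b, 𝓕 A a * 𝓕 D b * χ (a + b) = 0) : ∫ y, A y * D y * 𝓕 χ y = 0 := by
  set B := SchwartzMap.convolution (ContinuousLinearMap.mul ℂ ℂ) (𝓕⁻ A) (𝓕⁻ D) with hB
  have h1 : ∀ y, A y * D y = 𝓕 B y := fun y => by
    rw [hB, SchwartzMap.fourier_convolution]
    simp
  simp_rw [h1]
  have h2 := SchwartzMap.integral_fourier_mul_eq B (𝓕 χ)
  rw [h2]
  refine integral_eq_zero_of_ae (Eventually.of_forall fun ξ => ?_)
  have h3 : 𝓕 (𝓕 χ) ξ = χ (-ξ) := by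
    rw [← neg_neg ξ, ← fourierInv_apply_eq_fourier_neg, fourierInv_fourier_eq, neg_neg]
  simp only [h3, Pi.zero_apply, hB, SchwartzMap.convolution_apply]
  rw [MeasureTheory.convolution, ← integral_mul_const]
  refine integral_eq_zero_of_ae (Eventually.of_forall fun t => ?_)
  simp only [fourierInv_apply_eq_fourier_neg, ContinuousLinearMap.mul_apply', Pi.zero_apply]
  have := h (-t) (-(ξ - t))
  rwa [show -t + -(ξ - t) = -ξ by abel] at this

/-- The spectrum of a product: if `S₃(a + b) S₁(a) S₂(b) = 0` for all `a`, `b`, then the Fourier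
multiplier `S₃` annihilates the products of functions in the ranges of `S₁` and `S₂`. -/
theorem integral_conv_mul_conv_eq_zero {S₁ S₂ S₃ : 𝓢(E n, ℂ)}
    (h : ∀ a b, S₁ a * S₂ b * S₃ (a + b) = 0) {p₁ p₂ : ℝ≥0∞} (hp₁ : 1 ≤ p₁) (hp₂ : 1 ≤ p₂)
    {f g : E n → ℂ} (hf : MemLp f p₁ volume) (hg : MemLp g p₂ volume) (φ : 𝓢(E n, ℂ)) :
    ∫ y, 𝓕 (SchwartzMap.smulLeftCLM ℂ S₃ (𝓕⁻ φ)) y * (conv (𝓕⁻ S₁) f y * conv (𝓕⁻ S₂) g y) = 0 := by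
  set χ := SchwartzMap.smulLeftCLM ℂ S₃ (𝓕⁻ φ) with hχ
  have hu : Integrable fun y => 𝓕 χ y * conv (𝓕⁻ S₁) f y := by
    have := (memLp_top_conv (𝓕⁻ S₁) hp₁ hf).mul (memLp_one_iff_integrable.2 (𝓕 χ).integrable)
      (r := 1)
    exact memLp_one_iff_integrable.1 this
  -- Transpose the convolutions off `g` and then off `f`. The kernel left at each pair `(s, t)`
  -- involves only Schwartz functions, and it vanishes identically; no Fourier transform of `f` or
  -- `g` is taken.
  have e1 := integral_mul_conv (𝓕⁻ S₂) hp₂ hg hu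
  simp only [← mul_assoc]
  rw [e1]
  refine integral_eq_zero_of_ae (Eventually.of_forall fun t => ?_)
  simp only [Pi.zero_apply, mul_eq_zero]
  right
  set D := SchwartzMap.compSubConstCLM ℂ t (𝓕⁻ S₂) with hD
  have e2 := integral_mul_conv (𝓕⁻ S₁) hp₁ hf
    (SchwartzMap.pairing (ContinuousLinearMap.mul ℂ ℂ) D (𝓕 χ)).integrable
  have e3 : ∫ x, (𝓕⁻ S₂) (x - t) * (𝓕 χ x * conv (𝓕⁻ S₁) f x) =
      ∫ x, SchwartzMap.pairing (ContinuousLinearMap.mul ℂ ℂ) D (𝓕 χ) x * conv (𝓕⁻ S₁) f x := by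
    refine integral_congr_ae (Eventually.of_forall fun x => ?_)
    simp [hD, mul_assoc]
  rw [e3, e2]
  refine integral_eq_zero_of_ae (Eventually.of_forall fun s => ?_)
  simp only [Pi.zero_apply, mul_eq_zero]
  right
  -- Translating the two kernels only multiplies `S₁` and `S₂` by characters, so the support
  -- condition survives.
  have e4 := integral_mul_mul_fourier_eq_zero (A := SchwartzMap.compSubConstCLM ℂ s (𝓕⁻ S₁))
    (D := D) (χ := χ) fun a b => by
      rw [hD, fourier_compSubConstCLM, fourier_compSubConstCLM, hχ, fourier_fourierInv_eq,
        fourier_fourierInv_eq, SchwartzMap.smulLeftCLM_apply_apply S₃.hasTemperateGrowth]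
      simp only [Circle.smul_def, smul_eq_mul]
      linear_combination (Real.fourierChar (-inner ℝ s a) : ℂ) *
        (Real.fourierChar (-inner ℝ t b) : ℂ) * (𝓕⁻ φ) (a + b) * h a b
  rw [← e4]
  refine integral_congr_ae (Eventually.of_forall fun y => ?_)
  simp [mul_assoc]

end Multiplier

/-! ### The partition of unity and the operators `□_k` on `L^p` -/

section Decomposition

open FourierTransform

variable {n : ℕ}

@[simp] theorem lattice_apply (k : Fin n → ℤ) (i : Fin n) : lattice k i = k i := rfl

theorem lattice_add (k l : Fin n → ℤ) : lattice (k + l) = lattice k + lattice l := by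
  ext i; simp

theorem abs_apply_le_norm (x : E n) (i : Fin n) : |x i| ≤ ‖x‖ := by
  simpa using PiLp.norm_apply_le x i

theorem norm_le_of_abs_apply_le {x : E n} {r : ℝ} (hr : 0 ≤ r) (h : ∀ i, |x i| ≤ r) :
    ‖x‖ ≤ √n * r := by
  rw [EuclideanSpace.norm_eq]
  calc √(∑ i, ‖x i‖ ^ 2) ≤ √(∑ _i : Fin n, r ^ 2) := by
        gcongr with i
        simpa using h i
    _ = √n * r := by
        simp [Real.sqrt_sq hr]

/-- The lattice points in the closed cube with centre `x` and side length `2r`. -/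
def cubePoints (x : E n) (r : ℝ) : Finset (Fin n → ℤ) :=
  Fintype.piFinset fun i => Finset.Icc ⌈x i - r⌉ ⌊x i + r⌋

theorem mem_cubePoints {x : E n} {r : ℝ} {m : Fin n → ℤ} :
    m ∈ cubePoints x r ↔ ∀ i, |x i - m i| ≤ r := by
  simp only [cubePoints, Fintype.mem_piFinset, Finset.mem_Icc, Int.ceil_le, Int.le_floor, abs_le]
  refine forall_congr' fun i => ?_
  constructor <;> rintro ⟨h1, h2⟩ <;> constructor <;> linarith

theorem IsWindow.abs_apply_le {ρ : E n → ℝ} (hρ : IsWindow ρ) {ξ : E n} (h : ρ ξ ≠ 0) (i : Fin n) :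
    |ξ i| ≤ 1 :=
  hρ.support (subset_tsupport ρ h) i

/-- Any larger finite set is allowed, so that one index set can serve all points of a neighbourhood.
-/
theorem IsWindow.tsum_eq_sum {ρ : E n → ℝ} (hρ : IsWindow ρ) {ξ : E n} {s : Finset (Fin n → ℤ)}
    (hs : cubePoints ξ 1 ⊆ s) :
    ∑' m : Fin n → ℤ, ρ (ξ - lattice m) = ∑ m ∈ s, ρ (ξ - lattice m) := by
  refine _root_.tsum_eq_sum fun m hm => ?_
  by_contra h
  exact hm (hs (mem_cubePoints.2 fun i => by simpa using hρ.abs_apply_le h i))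

theorem IsWindow.one_le_tsum {ρ : E n → ℝ} (hρ : IsWindow ρ) (ξ : E n) :
    1 ≤ ∑' m : Fin n → ℤ, ρ (ξ - lattice m) := by
  rw [hρ.tsum_eq_sum subset_rfl]
  have h1 : ∀ i, |ξ i - (fun i => round (ξ i) : Fin n → ℤ) i| ≤ 1 / 2 := fun i =>
    abs_sub_round (ξ i)
  refine (hρ.eq_one (ξ - lattice fun i => round (ξ i)) h1).symm.le.trans ?_
  refine Finset.single_le_sum (f := fun m => ρ (ξ - lattice m)) (fun m _ => hρ.nonneg _) ?_
  exact mem_cubePoints.2 fun i => (h1 i).trans (by norm_num)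

theorem IsWindow.contDiff_tsum {ρ : E n → ℝ} (hρ : IsWindow ρ) :
    ContDiff ℝ ∞ fun ξ => ∑' m : Fin n → ℤ, ρ (ξ - lattice m) := by
  rw [contDiff_iff_contDiffAt]
  intro ξ₀
  have h : (fun ξ => ∑ m ∈ cubePoints ξ₀ 2, ρ (ξ - lattice m)) =ᶠ[𝓝 ξ₀]
      fun ξ => ∑' m : Fin n → ℤ, ρ (ξ - lattice m) := by
    filter_upwards [Metric.ball_mem_nhds ξ₀ one_pos] with ξ hξ
    refine (hρ.tsum_eq_sum fun m hm => ?_).symm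
    rw [mem_cubePoints] at hm ⊢
    intro i
    have h1 : |(ξ - ξ₀) i| ≤ 1 := (abs_apply_le_norm _ i).trans (by
      rw [← dist_eq_norm]; exact (Metric.mem_ball.1 hξ).le)
    have h2 := hm i
    simp only [PiLp.sub_apply] at h1
    rw [abs_le] at *
    constructor <;> linarith [h1.1, h1.2, h2.1, h2.2]
  refine ContDiffAt.congr_of_eventuallyEq ?_ h.symm
  refine ContDiff.contDiffAt (ContDiff.sum fun m _ => ?_)
  exact hρ.smooth.comp (contDiff_id.sub contDiff_const)

theorem IsWindow.contDiff_sigma {ρ : E n → ℝ} (hρ : IsWindow ρ) (k : Fin n → ℤ) :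
    ContDiff ℝ ∞ (sigma ρ k) := by
  refine ContDiff.div (hρ.smooth.comp (contDiff_id.sub contDiff_const)) hρ.contDiff_tsum fun ξ => ?_
  have := hρ.one_le_tsum ξ
  positivity

theorem IsWindow.abs_sub_le_of_sigma_ne_zero {ρ : E n → ℝ} (hρ : IsWindow ρ) {k : Fin n → ℤ}
    {ξ : E n} (h : sigma ρ k ξ ≠ 0) (i : Fin n) : |ξ i - k i| ≤ 1 := by
  have h1 : ρ (ξ - lattice k) ≠ 0 := fun h0 => h (by simp [sigma, h0])
  simpa using hρ.abs_apply_le h1 i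

theorem IsWindow.sum_sigma {ρ : E n → ℝ} (hρ : IsWindow ρ) {ξ : E n} {s : Finset (Fin n → ℤ)}
    (hs : cubePoints ξ 1 ⊆ s) : ∑ k ∈ s, sigma ρ k ξ = 1 := by
  unfold sigma
  have := hρ.one_le_tsum ξ
  rw [← Finset.sum_div, ← hρ.tsum_eq_sum hs, div_self]
  positivity

theorem sigma_sub_lattice (ρ : E n → ℝ) (k : Fin n → ℤ) (ξ : E n) :
    sigma ρ 0 (ξ - lattice k) = sigma ρ k ξ := by
  unfold sigma
  congr 1
  · congr 1
    ext i
    simp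
  · rw [← (Equiv.addLeft k).tsum_eq fun m => ρ (ξ - lattice m)]
    refine tsum_congr fun m => ?_
    simp [lattice_add, sub_sub]

/-- The symbol `ξ ↦ σ_k(2πξ)` of `□_k`, as a Schwartz function. -/
def IsWindow.symbol {ρ : E n → ℝ} (hρ : IsWindow ρ) (k : Fin n → ℤ) : 𝓢(E n, ℂ) :=
  HasCompactSupport.toSchwartzMap
    (f := fun ξ : E n => ((sigma ρ k ((2 * Real.pi) • ξ) : ℝ) : ℂ))
    (HasCompactSupport.intro (isCompact_closedBall (0 : E n) (√n * (1 + ‖lattice k‖)))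
      fun ξ hξ => by
        by_contra h
        refine hξ (mem_closedBall_zero_iff.2 (norm_le_of_abs_apply_le (by positivity) fun i => ?_))
        have h1 := hρ.abs_sub_le_of_sigma_ne_zero (k := k) (ξ := (2 * Real.pi) • ξ)
          (by simpa using h) i
        have h2 := abs_apply_le_norm (lattice k) i
        have h3 : |ξ i| ≤ |((2 * Real.pi) • ξ) i| := by
          rw [PiLp.smul_apply, smul_eq_mul, abs_mul]
          refine le_mul_of_one_le_left (abs_nonneg _) ?_
          rw [abs_of_pos Real.two_pi_pos]
          linarith [Real.pi_gt_three]
        have h4 := abs_sub_abs_le_abs_sub (((2 * Real.pi) • ξ) i) (k i)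
        simp only [lattice_apply] at h2
        linarith)
    (Complex.ofRealCLM.contDiff.comp ((hρ.contDiff_sigma k).comp (contDiff_const_smul _)))

theorem IsWindow.symbol_apply {ρ : E n → ℝ} (hρ : IsWindow ρ) (k : Fin n → ℤ) (ξ : E n) :
    hρ.symbol k ξ = ((sigma ρ k ((2 * Real.pi) • ξ) : ℝ) : ℂ) := rfl

theorem IsWindow.box_eq {ρ : E n → ℝ} (hρ : IsWindow ρ) (k : Fin n → ℤ) :
    box ρ k = TemperedDistribution.fourierMultiplierCLM ℂ (hρ.symbol k) := rfl

theorem IsWindow.abs_sub_le_of_symbol_ne_zero {ρ : E n → ℝ} (hρ : IsWindow ρ) {k : Fin n → ℤ}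
    {ξ : E n} (h : hρ.symbol k ξ ≠ 0) (i : Fin n) : |2 * Real.pi * ξ i - k i| ≤ 1 := by
  simpa using hρ.abs_sub_le_of_sigma_ne_zero (k := k) (ξ := (2 * Real.pi) • ξ)
    (by rw [hρ.symbol_apply] at h; exact_mod_cast h) i

theorem IsWindow.sum_symbol {ρ : E n → ℝ} (hρ : IsWindow ρ) {ξ : E n} {s : Finset (Fin n → ℤ)}
    (hs : cubePoints ((2 * Real.pi) • ξ) 1 ⊆ s) : ∑ k ∈ s, hρ.symbol k ξ = 1 := by
  simp only [hρ.symbol_apply]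
  rw [← Complex.ofReal_sum, hρ.sum_sigma hs, Complex.ofReal_one]

theorem IsWindow.symbol_eq_compSubConstCLM {ρ : E n → ℝ} (hρ : IsWindow ρ) (k : Fin n → ℤ) :
    hρ.symbol k =
      SchwartzMap.compSubConstCLM ℂ ((2 * Real.pi)⁻¹ • lattice k) (hρ.symbol 0) := by
  ext ξ
  rw [SchwartzMap.compSubConstCLM_apply, hρ.symbol_apply, hρ.symbol_apply, smul_sub,
    smul_inv_smul₀ Real.two_pi_pos.ne', sigma_sub_lattice]

theorem IsWindow.norm_kernel {ρ : E n → ℝ} (hρ : IsWindow ρ) (k : Fin n → ℤ) (x : E n) :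
    ‖(𝓕⁻ (hρ.symbol k)) x‖ = ‖(𝓕⁻ (hρ.symbol 0)) x‖ := by
  rw [fourierInv_apply_eq_fourier_neg, fourierInv_apply_eq_fourier_neg, hρ.symbol_eq_compSubConstCLM, fourier_compSubConstCLM, Circle.norm_smul]

/-- The symbols are translates of one another, so their kernels differ by characters only. Hence the
operators `□_k` are bounded uniformly in `k`. -/
theorem IsWindow.kernelNorm_eq {ρ : E n → ℝ} (hρ : IsWindow ρ) (k : Fin n → ℤ) :
    kernelNorm (𝓕⁻ (hρ.symbol k)) = kernelNorm (𝓕⁻ (hρ.symbol 0)) := by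
  have h : ∀ x, ‖(𝓕⁻ (hρ.symbol k)) x‖ₑ = ‖(𝓕⁻ (hρ.symbol 0)) x‖ₑ := fun x => by
    rw [← ofReal_norm, hρ.norm_kernel, ofReal_norm]
  simp only [kernelNorm, h]

/-- The bound for the operators `□_k` on `L^p`. -/
def IsWindow.bound {ρ : E n → ℝ} (hρ : IsWindow ρ) : ℝ≥0 :=
  (kernelNorm (𝓕⁻ (hρ.symbol 0))).toNNReal

theorem IsWindow.coe_bound {ρ : E n → ℝ} (hρ : IsWindow ρ) (k : Fin n → ℤ) :
    (hρ.bound : ℝ≥0∞) = kernelNorm (𝓕⁻ (hρ.symbol k)) := by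
  rw [hρ.kernelNorm_eq, IsWindow.bound, ENNReal.coe_toNNReal (kernelNorm_lt_top _).ne]

/-- The exponents may differ: this later identifies an `L^∞` representative with the original `L^p`
function. -/
theorem ae_eq_of_toTemperedDistribution_eq {p q : ℝ≥0∞} [hp : Fact (1 ≤ p)] [hq : Fact (1 ≤ q)]
    {f : Lp ℂ p (volume : Measure (E n))} {g : Lp ℂ q (volume : Measure (E n))}
    (h : Lp.toTemperedDistribution f = Lp.toTemperedDistribution g) : f =ᵐ[volume] g := by
  refine ae_eq_of_integral_contDiff_smul_eq ((Lp.memLp f).locallyIntegrable hp.out)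
    ((Lp.memLp g).locallyIntegrable hq.out) fun φ φ_smooth φ_cpt => ?_
  have hg₁ : HasCompactSupport (Complex.ofRealCLM ∘ φ) := φ_cpt.comp_left rfl
  have hg₂ : ContDiff ℝ ∞ (Complex.ofRealCLM ∘ φ) := by fun_prop
  have := DFunLike.congr_fun h (hg₁.toSchwartzMap hg₂)
  simpa [Lp.toTemperedDistribution_apply] using this

theorem toTemperedDistribution_injective {p : ℝ≥0∞} [Fact (1 ≤ p)] :
    Function.Injective fun f : Lp ℂ p (volume : Measure (E n)) => Lp.toTemperedDistribution f :=
  fun _ _ h => Lp.ext (ae_eq_of_toTemperedDistribution_eq h)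

theorem toTemperedDistribution_zero {p : ℝ≥0∞} [Fact (1 ≤ p)] :
    Lp.toTemperedDistribution (0 : Lp ℂ p (volume : Measure (E n))) = 0 :=
  map_zero (Lp.toTemperedDistributionCLM ℂ (volume : Measure (E n)) p)

theorem distENorm_toTemperedDistribution {p : ℝ≥0∞} [Fact (1 ≤ p)]
    (f : Lp ℂ p (volume : Measure (E n))) : distENorm p (Lp.toTemperedDistribution f) = ‖f‖ₑ := by
  unfold distENorm
  refine le_antisymm (iInf_le_of_le f (iInf_le_of_le rfl le_rfl)) (le_iInf₂ fun g hg => ?_)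
  rw [toTemperedDistribution_injective hg]

theorem IsWindow.toTemperedDistribution_toLp_conv {ρ : E n → ℝ} (hρ : IsWindow ρ) (k : Fin n → ℤ)
    {p r : ℝ≥0∞} [Fact (1 ≤ p)] [Fact (1 ≤ r)] (f : Lp ℂ p (volume : Measure (E n)))
    (h : MemLp (conv (𝓕⁻ (hρ.symbol k)) f) r volume) :
    Lp.toTemperedDistribution (h.toLp _) = box ρ k (Lp.toTemperedDistribution f) := by
  ext φ
  rw [hρ.box_eq, fourierMultiplierCLM_toTemperedDistribution, Lp.toTemperedDistribution_apply]
  refine integral_congr_ae ?_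
  filter_upwards [h.coeFn_toLp] with x hx
  rw [hx, smul_eq_mul]

/-- The operator `□_k` on `L^p`. -/
def IsWindow.boxLp {ρ : E n → ℝ} (hρ : IsWindow ρ) (p : ℝ≥0∞) [hp : Fact (1 ≤ p)] (k : Fin n → ℤ) :
    Lp ℂ p (volume : Measure (E n)) →L[ℂ] Lp ℂ p (volume : Measure (E n)) :=
  LinearMap.mkContinuous
    { toFun := fun f => (memLp_conv (𝓕⁻ (hρ.symbol k)) hp.out (Lp.memLp f)).toLp _
      -- Linearity is inherited from `box`, because `L^p` functions embed injectively into the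
      -- tempered distributions.
      map_add' := fun f g => toTemperedDistribution_injective <| by
        have h := map_add (Lp.toTemperedDistributionCLM ℂ (volume : Measure (E n)) p)
        simp only [Lp.toTemperedDistributionCLM_apply] at h
        simp only [h, hρ.toTemperedDistribution_toLp_conv, map_add]
      map_smul' := fun c f => toTemperedDistribution_injective <| by
        have h := map_smul (Lp.toTemperedDistributionCLM ℂ (volume : Measure (E n)) p)
        simp only [Lp.toTemperedDistributionCLM_apply] at h
        simp only [h, hρ.toTemperedDistribution_toLp_conv, map_smul, RingHom.id_apply] }
    hρ.bound fun f => by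
      have h := eLpNorm_conv_le (𝓕⁻ (hρ.symbol k)) hp.out (Lp.memLp f).1
      rw [← hρ.coe_bound, ← Lp.enorm_def] at h
      rw [LinearMap.coe_mk, AddHom.coe_mk, Lp.norm_toLp]
      refine (ENNReal.toReal_mono (by finiteness) h).trans_eq ?_
      simp [ENNReal.toReal_mul]

theorem IsWindow.toTemperedDistribution_boxLp {ρ : E n → ℝ} (hρ : IsWindow ρ) {p : ℝ≥0∞}
    [hp : Fact (1 ≤ p)] (k : Fin n → ℤ) (f : Lp ℂ p (volume : Measure (E n))) :
    Lp.toTemperedDistribution (hρ.boxLp p k f) = box ρ k (Lp.toTemperedDistribution f) :=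
  hρ.toTemperedDistribution_toLp_conv k f (memLp_conv _ hp.out (Lp.memLp f))

theorem IsWindow.coeFn_boxLp {ρ : E n → ℝ} (hρ : IsWindow ρ) {p : ℝ≥0∞}
    [hp : Fact (1 ≤ p)] (k : Fin n → ℤ) (f : Lp ℂ p (volume : Measure (E n))) :
    hρ.boxLp p k f =ᵐ[volume] conv (𝓕⁻ (hρ.symbol k)) f :=
  (memLp_conv (𝓕⁻ (hρ.symbol k)) hp.out (Lp.memLp f)).coeFn_toLp

theorem IsWindow.enorm_boxLp_le {ρ : E n → ℝ} (hρ : IsWindow ρ) {p : ℝ≥0∞}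
    [hp : Fact (1 ≤ p)] (k : Fin n → ℤ) (f : Lp ℂ p (volume : Measure (E n))) :
    ‖hρ.boxLp p k f‖ₑ ≤ hρ.bound * ‖f‖ₑ := by
  rw [Lp.enorm_def, Lp.enorm_def, eLpNorm_congr_ae (hρ.coeFn_boxLp k f), hρ.coe_bound k]
  exact eLpNorm_conv_le _ hp.out (Lp.memLp f).1

theorem IsWindow.distENorm_box {ρ : E n → ℝ} (hρ : IsWindow ρ) {p : ℝ≥0∞}
    [hp : Fact (1 ≤ p)] (k : Fin n → ℤ) (f : Lp ℂ p (volume : Measure (E n))) :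
    distENorm p (box ρ k (Lp.toTemperedDistribution f)) = ‖hρ.boxLp p k f‖ₑ := by
  rw [← hρ.toTemperedDistribution_boxLp, distENorm_toTemperedDistribution]

/-! ### Almost orthogonality -/

theorem IsWindow.mem_cubePoints_of_symbol_mul_ne_zero {ρ : E n → ℝ} (hρ : IsWindow ρ)
    {k l : Fin n → ℤ} {ξ : E n} (h : hρ.symbol k ξ * hρ.symbol l ξ ≠ 0) :
    l ∈ cubePoints (lattice k) 2 := by
  rw [mul_ne_zero_iff] at h
  refine mem_cubePoints.2 fun i => ?_
  have h1 := hρ.abs_sub_le_of_symbol_ne_zero h.1 i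
  have h2 := hρ.abs_sub_le_of_symbol_ne_zero h.2 i
  rw [lattice_apply]
  rw [abs_le] at *
  constructor <;> linarith [h1.1, h1.2, h2.1, h2.2]

theorem IsWindow.box_box_eq_zero {ρ : E n → ℝ} (hρ : IsWindow ρ) {k l : Fin n → ℤ}
    (h : l ∉ cubePoints (lattice k) 2) (u : 𝓢'(E n, ℂ)) : box ρ k (box ρ l u) = 0 := by
  rw [hρ.box_eq, hρ.box_eq, TemperedDistribution.fourierMultiplierCLM_fourierMultiplierCLM_apply
    (hρ.symbol l).hasTemperateGrowth (hρ.symbol k).hasTemperateGrowth]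
  have : (hρ.symbol l : E n → ℂ) * (hρ.symbol k : E n → ℂ) = fun _ => 0 := by
    ext ξ
    by_contra h0
    exact h (hρ.mem_cubePoints_of_symbol_mul_ne_zero (by rwa [mul_comm]))
  rw [this, TemperedDistribution.fourierMultiplierCLM_const]
  simp

theorem IsWindow.box_box_comm {ρ : E n → ℝ} (hρ : IsWindow ρ) (k l : Fin n → ℤ)
    (u : 𝓢'(E n, ℂ)) : box ρ k (box ρ l u) = box ρ l (box ρ k u) := by
  rw [hρ.box_eq, hρ.box_eq, TemperedDistribution.fourierMultiplierCLM_fourierMultiplierCLM_apply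
    (hρ.symbol l).hasTemperateGrowth (hρ.symbol k).hasTemperateGrowth,
    TemperedDistribution.fourierMultiplierCLM_fourierMultiplierCLM_apply
    (hρ.symbol k).hasTemperateGrowth (hρ.symbol l).hasTemperateGrowth, mul_comm]

/-- On the support of `σ_k` only the `σ_l` with `l` within distance `2` of `k` in each coordinate
are nonzero, and they add up to `1`. -/
theorem IsWindow.sum_box_box {ρ : E n → ℝ} (hρ : IsWindow ρ) (k : Fin n → ℤ)
    (u : 𝓢'(E n, ℂ)) : ∑ l ∈ cubePoints (lattice k) 2, box ρ l (box ρ k u) = box ρ k u := by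
  have h1 : ∀ l ∈ cubePoints (lattice k) 2, Function.HasTemperateGrowth (hρ.symbol l) := fun l _ =>
    (hρ.symbol l).hasTemperateGrowth
  have h2 := TemperedDistribution.fourierMultiplierCLM_sum ℂ h1
  have h3 := TemperedDistribution.fourierMultiplierCLM_fourierMultiplierCLM_apply (F := ℂ)
    (hρ.symbol k).hasTemperateGrowth (Function.HasTemperateGrowth.sum h1) u
  rw [h2] at h3
  simp only [hρ.box_eq]
  rw [sum_apply] at h3
  rw [h3]
  congr 1
  congr 1
  ext ξ
  simp only [Pi.mul_apply]
  by_cases h0 : hρ.symbol k ξ = 0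
  · simp [h0]
  · rw [hρ.sum_symbol, mul_one]
    intro l hl
    rw [mem_cubePoints] at hl ⊢
    intro i
    have h4 := hρ.abs_sub_le_of_symbol_ne_zero h0 i
    have h5 := hl i
    simp only [PiLp.smul_apply, smul_eq_mul] at h5
    rw [lattice_apply]
    rw [abs_le] at *
    constructor <;> linarith [h4.1, h4.2, h5.1, h5.2]

theorem card_cubePoints_lattice (k : Fin n → ℤ) (r : ℤ) :
    (cubePoints (lattice k) r).card = (2 * r + 1).toNat ^ n := by
  simp only [cubePoints, lattice_apply, Fintype.card_piFinset]
  have h1 : ∀ i, ⌈(k i : ℝ) - r⌉ = k i - r := fun i => by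
    exact_mod_cast Int.ceil_intCast (R := ℝ) (k i - r)
  have h2 : ∀ i, ⌊(k i : ℝ) + r⌋ = k i + r := fun i => by
    exact_mod_cast Int.floor_intCast (R := ℝ) (k i + r)
  simp only [h1, h2, Int.card_Icc]
  rw [Finset.prod_congr rfl fun i _ => show (k i + r + 1 - (k i - r)).toNat = (2 * r + 1).toNat by
    congr 1; ring]
  simp

/-- Bernstein's inequality `‖□_k f‖_∞ ≤ C ‖□_k f‖_p`. -/
theorem IsWindow.exists_lp_top_box {ρ : E n → ℝ} (hρ : IsWindow ρ) {p : ℝ≥0∞}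
    [hp : Fact (1 ≤ p)] (k : Fin n → ℤ) (f : Lp ℂ p (volume : Measure (E n))) :
    ∃ F : Lp ℂ ⊤ (volume : Measure (E n)),
      Lp.toTemperedDistribution F = box ρ k (Lp.toTemperedDistribution f) ∧
      ‖F‖ₑ ≤ 5 ^ n * hρ.bound * ‖hρ.boxLp p k f‖ₑ := by
  -- Reproduce `□_k f` as `∑ □_l □_k f` over the `5^n` neighbours `l`; each outer operator maps
  -- `L^p` into `L^∞`.
  have hm := fun l => memLp_top_conv (𝓕⁻ (hρ.symbol l)) hp.out (Lp.memLp (hρ.boxLp p k f))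
  refine ⟨∑ l ∈ cubePoints (lattice k) 2, (hm l).toLp _, ?_, ?_⟩
  · have h := map_sum (Lp.toTemperedDistributionCLM ℂ (volume : Measure (E n)) ⊤)
      (fun l => (hm l).toLp _) (cubePoints (lattice k) 2)
    simp only [Lp.toTemperedDistributionCLM_apply] at h
    rw [h, ← hρ.sum_box_box]
    refine Finset.sum_congr rfl fun l _ => ?_
    rw [hρ.toTemperedDistribution_toLp_conv, hρ.toTemperedDistribution_boxLp]
  · calc _ ≤ ∑ l ∈ cubePoints (lattice k) 2, ‖(hm l).toLp _‖ₑ := enorm_sum_le _ _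
      _ ≤ ∑ l ∈ cubePoints (lattice k) 2, hρ.bound * ‖hρ.boxLp p k f‖ₑ := by
          gcongr with l
          rw [Lp.enorm_toLp, hρ.coe_bound l, Lp.enorm_def]
          exact eLpNorm_top_conv_le _ hp.out (Lp.memLp _).1
      _ = _ := by
          have h5 : (cubePoints (lattice k) 2).card = 5 ^ n := by
            exact_mod_cast card_cubePoints_lattice k 2
          rw [Finset.sum_const, h5, nsmul_eq_mul, mul_assoc]
          norm_num

/-- `□_k(□_l f □_m g) = 0` unless `k` is close to `l + m`. -/
theorem IsWindow.box_mul_eq_zero {ρ : E n → ℝ} (hρ : IsWindow ρ) {p₁ p₂ p : ℝ≥0∞}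
    [hp₁ : Fact (1 ≤ p₁)] [hp₂ : Fact (1 ≤ p₂)] [hp : Fact (1 ≤ p)] {k l m : Fin n → ℤ}
    (hk : k - l - m ∉ cubePoints (0 : E n) 3) (f : Lp ℂ p₁ (volume : Measure (E n)))
    (g : Lp ℂ p₂ (volume : Measure (E n))) {h : Lp ℂ p (volume : Measure (E n))}
    (hh : h =ᵐ[volume] fun x => hρ.boxLp p₁ l f x * hρ.boxLp p₂ m g x) :
    box ρ k (Lp.toTemperedDistribution h) = 0 := by
  ext φ
  rw [hρ.box_eq, TemperedDistribution.fourierMultiplierCLM_apply_apply,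
    Lp.toTemperedDistribution_apply]
  have key := integral_conv_mul_conv_eq_zero (S₁ := hρ.symbol l) (S₂ := hρ.symbol m)
    (S₃ := hρ.symbol k) (fun a b => by
      by_contra h0
      simp only [mul_ne_zero_iff] at h0
      refine hk (mem_cubePoints.2 fun i => ?_)
      have h1 := hρ.abs_sub_le_of_symbol_ne_zero h0.1.1 i
      have h2 := hρ.abs_sub_le_of_symbol_ne_zero h0.1.2 i
      have h3 := hρ.abs_sub_le_of_symbol_ne_zero h0.2 i
      simp only [PiLp.add_apply, mul_add] at h3
      simp only [PiLp.zero_apply, Pi.sub_apply, Int.cast_sub]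
      rw [abs_le] at *
      constructor <;> linarith [h1.1, h1.2, h2.1, h2.2, h3.1, h3.2])
    hp₁.out hp₂.out (Lp.memLp f) (Lp.memLp g) φ
  simp only [zero_apply]
  rw [← key]
  refine integral_congr_ae ?_
  filter_upwards [hh, hρ.coeFn_boxLp l f, hρ.coeFn_boxLp m g] with x h1 h2 h3
  rw [h1, h2, h3, smul_eq_mul]

end Decomposition

/-! ### Recovering a function from its frequency pieces -/

section Reconstruction

open FourierTransform

variable {n : ℕ}

/-- A smooth cut-off function. -/
def cutoff (n : ℕ) : ContDiffBump (0 : E n) := ⟨1, 2, one_pos, one_lt_two⟩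

/-- The dilated cut-off function. -/
def dilatedCutoff (n : ℕ) (a : ℝ) (ξ : E n) : ℂ := (cutoff n (a • ξ) : ℂ)

theorem hasTemperateGrowth_dilatedCutoff (a : ℝ) :
    (dilatedCutoff n a).HasTemperateGrowth := by
  have h1 : (fun x : E n => cutoff n x).HasTemperateGrowth :=
    (cutoff n).hasCompactSupport.hasTemperateGrowth (cutoff n).contDiff
  have h2 : (fun ξ : E n => a • ξ).HasTemperateGrowth := by fun_prop
  have h3 : (fun x : ℝ => (x : ℂ)).HasTemperateGrowth := by fun_prop
  exact h3.comp (h1.comp h2)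

/-- The function vanishes on the unit ball, and outside it a constant bound is also a bound linear
in `‖y‖`. After dilation this linear factor supplies the decay in `a`. -/
theorem exists_norm_iteratedFDeriv_one_sub_cutoff_le (i : ℕ) :
    ∃ B : ℝ, 0 ≤ B ∧ ∀ y : E n,
      ‖iteratedFDeriv ℝ i (fun y : E n => 1 - (cutoff n y : ℂ)) y‖ ≤ B * ‖y‖ := by
  have hc : ContDiff ℝ ∞ fun y : E n => (cutoff n y : ℂ) :=
    Complex.ofRealCLM.contDiff.comp (cutoff n).contDiff
  have hcs : HasCompactSupport fun y : E n => (cutoff n y : ℂ) :=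
    (cutoff n).hasCompactSupport.comp_left (g := fun x : ℝ => (x : ℂ)) Complex.ofReal_zero
  obtain ⟨C, hC⟩ := (hcs.iteratedFDeriv i).exists_bound_of_continuous
    (hc.continuous_iteratedFDeriv (𝕜 := ℝ) (m := i) (mod_cast le_top))
  have hC0 : 0 ≤ C := (norm_nonneg _).trans (hC 0)
  refine ⟨1 + C, by linarith, fun y => ?_⟩
  by_cases hy : ‖y‖ < 1
  · have h1 : (fun y : E n => 1 - (cutoff n y : ℂ)) =ᶠ[𝓝 y] fun _ => 0 := by
      filter_upwards [Metric.isOpen_ball.mem_nhds (mem_ball_zero_iff.2 hy)] with z hz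
      rw [(cutoff n).one_of_mem_closedBall (Metric.ball_subset_closedBall hz)]
      simp
    rw [(h1.iteratedFDeriv ℝ i).eq_of_nhds, iteratedFDeriv_fun_zero]
    simp only [Pi.zero_apply, norm_zero]
    positivity
  · have h2 : iteratedFDeriv ℝ i (fun y : E n => 1 - (cutoff n y : ℂ)) y =
        iteratedFDeriv ℝ i (fun _ : E n => (1 : ℂ)) y -
          iteratedFDeriv ℝ i (fun y : E n => (cutoff n y : ℂ)) y :=
      iteratedFDeriv_sub_apply contDiff_const.contDiffAt (hc.of_le (mod_cast le_top)).contDiffAt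
    have h3 : ‖iteratedFDeriv ℝ i (fun _ : E n => (1 : ℂ)) y‖ ≤ 1 := by
      rcases eq_or_ne i 0 with rfl | hi
      · simp
      · rw [iteratedFDeriv_const_of_ne hi]
        simp
    calc _ ≤ 1 + C := by
          rw [h2]
          exact (norm_sub_le _ _).trans (add_le_add h3 (hC y))
      _ ≤ (1 + C) * ‖y‖ := le_mul_of_one_le_right (by linarith) (not_lt.1 hy)

/-- In the Leibniz formula the factor `1 - cutoff(a x)` costs `a ‖x‖`; the extra `‖x‖` is absorbed
by passing from weight `k` to `k + 1`. -/
theorem exists_seminorm_cutoff_sub_le (ψ : 𝓢(E n, ℂ)) (k m : ℕ) :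
    ∃ C : ℝ, 0 ≤ C ∧ ∀ a : ℝ, 0 ≤ a → a ≤ 1 →
      SchwartzMap.seminorm ℂ k m (SchwartzMap.smulLeftCLM ℂ (dilatedCutoff n a) ψ - ψ) ≤ C * a := by
  choose B hB0 hB using exists_norm_iteratedFDeriv_one_sub_cutoff_le (n := n)
  set g : E n → ℂ := fun y => 1 - (cutoff n y : ℂ) with hg
  have hgc : ContDiff ℝ ∞ g :=
    contDiff_const.sub (Complex.ofRealCLM.contDiff.comp (cutoff n).contDiff)
  refine ⟨∑ i ∈ Finset.range (m + 1), (m.choose i : ℝ) * B i *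
    SchwartzMap.seminorm ℂ (k + 1) (m - i) ψ,
    Finset.sum_nonneg fun i _ => mul_nonneg (mul_nonneg (by positivity) (hB0 i)) (apply_nonneg _ _),
    fun a ha0 ha1 => ?_⟩
  refine SchwartzMap.seminorm_le_bound ℂ k m _ (mul_nonneg (Finset.sum_nonneg fun i _ =>
    mul_nonneg (mul_nonneg (by positivity) (hB0 i)) (apply_nonneg _ _)) ha0) fun x => ?_
  have e1 : ((SchwartzMap.smulLeftCLM ℂ (dilatedCutoff n a) ψ - ψ : 𝓢(E n, ℂ)) : E n → ℂ) =
      -fun x => g (a • x) * ψ x := by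
    ext x
    simp only [sub_apply, Pi.neg_apply,
      SchwartzMap.smulLeftCLM_apply_apply (hasTemperateGrowth_dilatedCutoff a), smul_eq_mul,
      dilatedCutoff, hg]
    ring
  have hga : ContDiff ℝ ∞ fun x => g (a • x) := hgc.comp (contDiff_const_smul a)
  rw [e1, iteratedFDeriv_neg_apply, norm_neg]
  have h1 := norm_iteratedFDeriv_mul_le hga (ψ.smooth ⊤) x (n := m) (mod_cast le_top)
  calc _ ≤ ‖x‖ ^ k * ∑ i ∈ Finset.range (m + 1), (m.choose i : ℝ) *
        ‖iteratedFDeriv ℝ i (fun x => g (a • x)) x‖ * ‖iteratedFDeriv ℝ (m - i) ψ x‖ := by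
        gcongr
    _ ≤ ‖x‖ ^ k * ∑ i ∈ Finset.range (m + 1), (m.choose i : ℝ) *
        (B i * (a * ‖x‖)) * ‖iteratedFDeriv ℝ (m - i) ψ x‖ := by
        gcongr with i
        rw [iteratedFDeriv_comp_const_smul a (hgc.of_le (mod_cast le_top))]
        simp only [norm_smul, norm_pow, Real.norm_eq_abs, abs_of_nonneg ha0]
        calc _ ≤ 1 * ‖iteratedFDeriv ℝ i g (a • x)‖ := by
              gcongr
              exact pow_le_one₀ ha0 ha1
          _ ≤ B i * ‖a • x‖ := by
              rw [one_mul]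
              exact hB i _
          _ = _ := by rw [norm_smul, Real.norm_eq_abs, abs_of_nonneg ha0]
    _ = ∑ i ∈ Finset.range (m + 1), (m.choose i : ℝ) * B i *
        (‖x‖ ^ (k + 1) * ‖iteratedFDeriv ℝ (m - i) ψ x‖) * a := by
        rw [Finset.mul_sum]
        refine Finset.sum_congr rfl fun i _ => ?_
        ring
    _ ≤ ∑ i ∈ Finset.range (m + 1), (m.choose i : ℝ) * B i *
        SchwartzMap.seminorm ℂ (k + 1) (m - i) ψ * a := by
        gcongr with i
        · exact mul_nonneg (by positivity) (hB0 i)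
        · exact SchwartzMap.le_seminorm ℂ _ _ ψ x
    _ = _ := by rw [Finset.sum_mul]

theorem tendsto_smulLeftCLM_dilatedCutoff (ψ : 𝓢(E n, ℂ)) :
    Tendsto (fun N : ℕ => SchwartzMap.smulLeftCLM ℂ (dilatedCutoff n (1 / ((N : ℝ) + 1))) ψ) atTop
      (𝓝 ψ) := by
  rw [(schwartz_withSeminorms ℂ (E n) ℂ).tendsto_nhds]
  rintro ⟨k, m⟩ ε hε
  obtain ⟨C, hC0, hC⟩ := exists_seminorm_cutoff_sub_le ψ k m
  have h1 : Tendsto (fun N : ℕ => C * (1 / ((N : ℝ) + 1))) atTop (𝓝 0) := by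
    simpa using tendsto_one_div_add_atTop_nhds_zero_nat.const_mul C
  filter_upwards [h1.eventually_lt_const hε] with N hN
  refine (hC _ (by positivity) ?_).trans_lt hN
  rw [div_le_one (by positivity)]
  linarith [N.cast_nonneg (α := ℝ)]

/-- Test functions with compactly supported inverse Fourier transform are finite sums of localized
pieces, on which `T` vanishes; by the dilated cut-offs they are dense. -/
theorem IsWindow.eq_zero_of_box_eq_zero {ρ : E n → ℝ} (hρ : IsWindow ρ) {T : 𝓢'(E n, ℂ)}
    (hT : ∀ k, box ρ k T = 0) : T = 0 := by
  ext φ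
  have h1 : Tendsto (fun N : ℕ => T (𝓕 (SchwartzMap.smulLeftCLM ℂ
      (dilatedCutoff n (1 / ((N : ℝ) + 1))) (𝓕⁻ φ)))) atTop (𝓝 (T φ)) := by
    have h2 := (fourierCLM ℂ 𝓢(E n, ℂ)).continuous.tendsto (𝓕⁻ φ)
    have h3 := (T.continuous.tendsto _).comp
      (h2.comp (tendsto_smulLeftCLM_dilatedCutoff (𝓕⁻ φ)))
    rw [fourierCLM_apply, fourier_fourierInv_eq] at h3
    exact h3
  refine tendsto_nhds_unique h1 ?_
  refine tendsto_const_nhds.congr fun N => ?_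
  set a : ℝ := 1 / ((N : ℝ) + 1) with ha
  have ha0 : 0 < a := by positivity
  set η := SchwartzMap.smulLeftCLM ℂ (dilatedCutoff n a) (𝓕⁻ φ) with hη
  -- The dilated cut-off lives in `‖ξ‖ ≤ 2 / a`; the symbols are evaluated at `2πξ`, and the final
  -- `1` is the size of the window's support.
  set F := cubePoints (0 : E n) (2 * Real.pi * (2 / a) + 1) with hF
  have h4 : η = ∑ k ∈ F, SchwartzMap.smulLeftCLM ℂ (hρ.symbol k) η := by
    ext ξ
    rw [sum_apply]
    simp only [SchwartzMap.smulLeftCLM_apply_apply (hρ.symbol _).hasTemperateGrowth, smul_eq_mul]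
    rw [← Finset.sum_mul]
    by_cases h0 : dilatedCutoff n a ξ = 0
    · rw [hη, SchwartzMap.smulLeftCLM_apply_apply (hasTemperateGrowth_dilatedCutoff a), h0]
      simp
    · rw [hρ.sum_symbol, one_mul]
      intro m hm
      rw [mem_cubePoints] at hm
      rw [hF, mem_cubePoints]
      intro i
      have h5 : ‖a • ξ‖ ≤ 2 := by
        by_contra h6
        refine h0 ?_
        simp only [dilatedCutoff, Complex.ofReal_eq_zero]
        exact (cutoff n).zero_of_le_dist (by simpa [cutoff] using (not_le.1 h6).le)
      rw [norm_smul, Real.norm_eq_abs, abs_of_pos ha0, mul_comm, ← le_div_iff₀ ha0] at h5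
      have h6 := (abs_apply_le_norm ξ i).trans h5
      have h7 := hm i
      simp only [PiLp.smul_apply, smul_eq_mul] at h7
      have h8 : |2 * Real.pi * ξ i| ≤ 2 * Real.pi * (2 / a) := by
        rw [abs_mul, abs_of_pos Real.two_pi_pos]
        gcongr
      simp only [PiLp.zero_apply]
      rw [abs_le] at *
      constructor <;> linarith [h7.1, h7.2, h8.1, h8.2]
  have h9 : 𝓕 η = ∑ k ∈ F, 𝓕 (SchwartzMap.smulLeftCLM ℂ (hρ.symbol k) η) := by
    conv_lhs => rw [h4]
    exact map_sum (fourierCLM ℂ 𝓢(E n, ℂ)) _ _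
  rw [h9, map_sum]
  symm
  refine Finset.sum_eq_zero fun k _ => ?_
  have h10 := DFunLike.congr_fun (hT k) (𝓕 η)
  rw [hρ.box_eq, TemperedDistribution.fourierMultiplierCLM_apply_apply,
    fourierInv_fourier_eq] at h10
  exact h10

theorem IsWindow.boxLp_boxLp_eq_zero {ρ : E n → ℝ} (hρ : IsWindow ρ) {p : ℝ≥0∞} [Fact (1 ≤ p)]
    {k l : Fin n → ℤ} (h : l ∉ cubePoints (lattice k) 2) (f : Lp ℂ p (volume : Measure (E n))) :
    hρ.boxLp p k (hρ.boxLp p l f) = 0 := by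
  refine toTemperedDistribution_injective ?_
  simp only
  rw [hρ.toTemperedDistribution_boxLp, hρ.toTemperedDistribution_boxLp, hρ.box_box_eq_zero h,
    toTemperedDistribution_zero]

theorem IsWindow.sum_boxLp_boxLp {ρ : E n → ℝ} (hρ : IsWindow ρ) {p : ℝ≥0∞} [Fact (1 ≤ p)]
    (k : Fin n → ℤ) (f : Lp ℂ p (volume : Measure (E n))) :
    ∑ l ∈ cubePoints (lattice k) 2, hρ.boxLp p k (hρ.boxLp p l f) = hρ.boxLp p k f := by
  refine toTemperedDistribution_injective ?_
  have h := map_sum (Lp.toTemperedDistributionCLM ℂ (volume : Measure (E n)) p)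
    (fun l => hρ.boxLp p k (hρ.boxLp p l f)) (cubePoints (lattice k) 2)
  simp only [Lp.toTemperedDistributionCLM_apply] at h
  simp only [h, hρ.toTemperedDistribution_boxLp]
  rw [← hρ.sum_box_box k]
  exact Finset.sum_congr rfl fun l _ => hρ.box_box_comm k l _

theorem summable_of_tsum_enorm_ne_top {ι F : Type*} [NormedAddCommGroup F] [CompleteSpace F]
    {f : ι → F} (h : ∑' i, ‖f i‖ₑ ≠ ⊤) : Summable f := by
  refine Summable.of_nnnorm ?_
  rw [← ENNReal.tsum_coe_ne_top_iff_summable]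
  exact h

theorem enorm_le_tsum_enorm_of_hasSum {ι F : Type*} [NormedAddCommGroup F]
    {f : ι → F} {a : F} (h : HasSum f a) : ‖a‖ₑ ≤ ∑' i, ‖f i‖ₑ :=
  le_of_tendsto' (Tendsto.enorm (f := fun s : Finset ι => ∑ i ∈ s, f i) h) fun s =>
    (enorm_sum_le _ _).trans (ENNReal.sum_le_tsum s)

/-- Absolute convergence provides some limit. By almost orthogonality it has the same pieces as `f`,
and a distribution all of whose pieces vanish is zero. -/
theorem IsWindow.hasSum_boxLp {ρ : E n → ℝ} (hρ : IsWindow ρ) {p : ℝ≥0∞} [Fact (1 ≤ p)]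
    (f : Lp ℂ p (volume : Measure (E n))) (hf : ∑' l, ‖hρ.boxLp p l f‖ₑ ≠ ⊤) :
    HasSum (fun l => hρ.boxLp p l f) f := by
  have hs : Summable fun l => hρ.boxLp p l f := summable_of_tsum_enorm_ne_top hf
  obtain ⟨f₀, hf₀⟩ := hs
  have h1 : ∀ k, hρ.boxLp p k f₀ = hρ.boxLp p k f := fun k => by
    have h2 := hf₀.mapL (hρ.boxLp p k)
    have h3 : HasSum (fun l => hρ.boxLp p k (hρ.boxLp p l f))
        (∑ l ∈ cubePoints (lattice k) 2, hρ.boxLp p k (hρ.boxLp p l f)) :=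
      hasSum_sum_of_ne_finset_zero fun l hl => hρ.boxLp_boxLp_eq_zero hl f
    rw [h2.unique h3, hρ.sum_boxLp_boxLp]
  have h4 : Lp.toTemperedDistribution (f₀ - f) = 0 := hρ.eq_zero_of_box_eq_zero fun k => by
    rw [← hρ.toTemperedDistribution_boxLp, map_sub, h1, sub_self, toTemperedDistribution_zero]
  have h5 := map_sub (Lp.toTemperedDistributionCLM ℂ (volume : Measure (E n)) p) f₀ f
  simp only [Lp.toTemperedDistributionCLM_apply] at h5
  rw [h5, sub_eq_zero] at h4
  rwa [toTemperedDistribution_injective h4] at hf₀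

end Reconstruction

/-! ### Admissible weights -/

theorem AdmissibleWeight.exists_concaveOn {w : ℝ → ℝ} (hw : AdmissibleWeight w) :
    ∃ τ : ℝ, 0 < τ ∧ ConcaveOn ℝ (Set.Ici τ) w := by
  obtain ⟨τ, hτ⟩ := hw.concave_end
  refine ⟨max τ 1, by positivity, ?_⟩
  have h1 : DifferentiableOn ℝ w (Set.Ioi 0) := hw.smooth.differentiableOn (by simp)
  have h2 : DifferentiableOn ℝ (deriv w) (Set.Ioi 0) :=
    (hw.smooth.deriv_of_isOpen isOpen_Ioi (m := ∞) (by simp)).differentiableOn (by simp)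
  have h3 : Set.Ici (max τ 1) ⊆ Set.Ioi 0 := fun x hx =>
    lt_of_lt_of_le (by positivity) (Set.mem_Ici.1 hx)
  have h4 : interior (Set.Ici (max τ 1)) ⊆ Set.Ioi 0 := interior_subset.trans h3
  refine concaveOn_of_deriv2_nonpos (convex_Ici _) (h1.continuousOn.mono h3) (h1.mono h4)
    (h2.mono h4) fun x hx => ?_
  rw [interior_Ici, Set.mem_Ioi] at hx
  exact (hτ x ((le_max_left _ _).trans_lt hx)).le

/-- The pairs `y, x + y` and `x, 2y` have equal sums and the second lies between the points of the
first; a concave function has the larger sum on the inner pair. -/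
theorem _root_.ConcaveOn.add_le_add_of_le {w : ℝ → ℝ} {τ : ℝ} (hτ : 0 < τ)
    (hw : ConcaveOn ℝ (Set.Ici τ) w) {x y : ℝ} (hy : τ ≤ y) (hyx : y ≤ x) :
    w (x + y) + w y ≤ w x + w (2 * y) := by
  have hx : 0 < x := by linarith
  have hs0 : 0 ≤ (x - y) / x := div_nonneg (by linarith) hx.le
  have hs1 : 0 ≤ y / x := div_nonneg (by linarith) hx.le
  have hs : (x - y) / x + y / x = 1 := by
    rw [← add_div, sub_add_cancel, div_self hx.ne']
  have m1 : y ∈ Set.Ici τ := hy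
  have m2 : x + y ∈ Set.Ici τ := by rw [Set.mem_Ici]; linarith
  have h1 := hw.2 m1 m2 hs1 hs0 (by linarith)
  have h2 := hw.2 m1 m2 hs0 hs1 hs
  simp only [smul_eq_mul] at h1 h2
  have e1 : y / x * y + (x - y) / x * (x + y) = x := by field_simp; ring
  have e2 : (x - y) / x * y + y / x * (x + y) = 2 * y := by field_simp; ring
  rw [e1] at h1
  rw [e2] at h2
  have h3 : w (x + y) + w y = (y / x * w y + (x - y) / x * w (x + y)) +
      ((x - y) / x * w y + y / x * w (x + y)) := by
    linear_combination (-(w (x + y) + w y)) * hs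
  linarith

theorem AdmissibleWeight.mono {w : ℝ → ℝ} (hw : AdmissibleWeight w) {x y : ℝ} (hx : 0 ≤ x)
    (hxy : x ≤ y) : w x ≤ w y :=
  hw.strictMono.monotoneOn hx (hx.trans hxy) hxy

/-- Subadditivity with a gain. -/
theorem AdmissibleWeight.exists_apply_add_le {w : ℝ → ℝ} (hw : AdmissibleWeight w) :
    ∃ c K : ℝ, c < 1 ∧ ∀ x y, 0 ≤ y → y ≤ x → w (x + y) ≤ w x + c * w y + K := by
  obtain ⟨τ, hτ0, hτ⟩ := hw.exists_concaveOn
  obtain ⟨α, hα0, hα1, hα⟩ := hw.regularlyVarying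
  have h2α : (2 : ℝ) ^ α < 2 := by
    simpa using Real.rpow_lt_rpow_of_exponent_lt (x := 2) (by norm_num) hα1
  have h2α0 : (0 : ℝ) < 2 ^ α := by positivity
  have h1 := (hα.tendsto 2 two_pos).eventually_lt_const (u := 1 + 2 ^ α / 2) (by linarith)
  obtain ⟨T, hT⟩ := eventually_atTop.1 (h1.and (eventually_ge_atTop τ))
  have hTτ : τ ≤ max T τ := le_max_right _ _
  set S := max T τ with hS
  have hS0 : 0 < S := hτ0.trans_le hTτ
  refine ⟨2 ^ α / 2, w (2 * S), by linarith, fun x y hy hyx => ?_⟩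
  have hw0 : ∀ t, 0 ≤ t → 0 ≤ w t := fun t ht => zero_le_one.trans (hw.one_le t ht)
  have hcy : 0 ≤ 2 ^ α / 2 * w y := mul_nonneg (by positivity) (hw0 y hy)
  by_cases hyS : S ≤ y
  · have h3 := hτ.add_le_add_of_le hτ0 (hTτ.trans hyS) hyx
    have h4 := (hT y ((le_max_left _ _).trans hyS)).1
    rw [div_lt_iff₀ (hα.pos y (hS0.trans_le hyS)), mul_comm y 2] at h4
    have := hw0 (2 * S) (by positivity)
    linarith
  -- For `y` below the threshold `S`, replacing `y` by `S` costs at most the constant `w(2S)`.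
  · have h5 : w (x + y) ≤ w (x + S) := hw.mono (by linarith) (by linarith)
    by_cases hxS : S ≤ x
    · have h3 := hτ.add_le_add_of_le hτ0 hTτ hxS
      have := hw0 S hS0.le
      linarith
    · have h6 : w (x + S) ≤ w (2 * S) := hw.mono (by linarith) (by linarith)
      have := hw0 x (by linarith)
      linarith

/-- The gain sits on the smaller argument; bounding it by the sum of both exponentials makes the
estimate symmetric. The shift `D` allows for the bounded discrepancy between `k` and `l + m`. -/
theorem AdmissibleWeight.exists_exp_le {w : ℝ → ℝ} (hw : AdmissibleWeight w) {D : ℝ}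
    (hD : 0 ≤ D) : ∃ δ K : ℝ, 0 < δ ∧ ∀ x y, 0 ≤ x → 0 ≤ y →
      Real.exp (w (x + y + D)) ≤ Real.exp K * (Real.exp (w x) * Real.exp (w y)) *
        (Real.exp (-(δ * w x)) + Real.exp (-(δ * w y))) := by
  obtain ⟨c, K, hc, hK⟩ := hw.exists_apply_add_le
  have hw0 : ∀ t, 0 ≤ t → 0 ≤ w t := fun t ht => zero_le_one.trans (hw.one_le t ht)
  set K' := max (c * w D + K) (w (2 * D)) with hK'
  have h1 : ∀ x, 0 ≤ x → w (x + D) ≤ w x + K' := fun x hx => by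
    by_cases h : D ≤ x
    · have := hK x D hD h
      linarith [le_max_left (c * w D + K) (w (2 * D))]
    · have := hw.mono (x := x + D) (y := 2 * D) (by linarith) (by linarith)
      linarith [le_max_right (c * w D + K) (w (2 * D)), hw0 x hx]
  have key : ∀ x y, 0 ≤ y → y ≤ x → Real.exp (w (x + y + D)) ≤
      Real.exp (K + K') * (Real.exp (w x) * Real.exp (w y)) * Real.exp (-((1 - c) * w y)) := by
    intro x y hy hyx
    rw [← Real.exp_add, ← Real.exp_add, ← Real.exp_add, Real.exp_le_exp]
    linarith [h1 (x + y) (by linarith), hK x y hy hyx]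
  refine ⟨1 - c, K + K', by linarith, fun x y hx hy => ?_⟩
  rcases le_total y x with h | h
  · refine (key x y hy h).trans ?_
    gcongr
    exact le_add_of_nonneg_left (Real.exp_pos _).le
  · rw [add_comm x y]
    refine (key y x hx h).trans ?_
    rw [mul_comm (Real.exp (w y))]
    gcongr
    exact le_add_of_nonneg_right (Real.exp_pos _).le

/-! ### Summability over the integer lattice -/

theorem lattice_eq_sum {n : ℕ} (k : Fin n → ℤ) :
    lattice k = ∑ i, k i • (EuclideanSpace.basisFun (Fin n) ℝ).toBasis i := by
  ext j
  simp [Finset.sum_apply, Pi.single_apply]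

theorem lattice_injective {n : ℕ} : Function.Injective (lattice : (Fin n → ℤ) → E n) := by
  intro k l h
  ext i
  have h2 : lattice k i = lattice l i := by rw [h]
  simpa using h2

theorem summable_norm_rpow_of_mem {ι F : Type*} [NormedAddCommGroup F] (L : AddSubgroup F)
    {e : ι → F} (he : Function.Injective e) (hmem : ∀ k, e k ∈ L) {r : ℝ}
    (h : Summable fun z : L => ‖(z : F)‖ ^ r) : Summable fun k => ‖e k‖ ^ r :=
  h.comp_injective (i := fun k => (⟨e k, hmem k⟩ : L)) fun _ _ hkl => he (congrArg Subtype.val hkl)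

theorem exists_summable_norm_lattice (n : ℕ) :
    ∃ r : ℝ, r < 0 ∧ Summable fun k : Fin n → ℤ => ‖(lattice k : E n)‖ ^ r := by
  obtain ⟨b, hb⟩ : ∃ b : Module.Basis (Fin n) ℝ (E n), ∀ k, lattice k = ∑ i, k i • b i :=
    ⟨_, lattice_eq_sum⟩
  obtain ⟨L, hL⟩ : ∃ L : Submodule ℤ (E n), L = Submodule.span ℤ (Set.range b) := ⟨_, rfl⟩
  have : DiscreteTopology L := by subst hL; infer_instance
  refine ⟨-(Module.finrank ℤ L : ℝ) - 1, by linarith [(Module.finrank ℤ L).cast_nonneg (α := ℝ)],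
    summable_norm_rpow_of_mem L.toAddSubgroup lattice_injective (fun k => ?_)
      (ZLattice.summable_norm_rpow L _ (by linarith))⟩
  rw [Submodule.mem_toAddSubgroup, hb, hL]
  exact Submodule.sum_mem _ fun i _ => Submodule.smul_mem _ _ (Submodule.subset_span ⟨i, rfl⟩)

theorem one_le_norm_lattice {n : ℕ} {k : Fin n → ℤ} (hk : k ≠ 0) : 1 ≤ ‖(lattice k : E n)‖ := by
  obtain ⟨i, hi⟩ := Function.ne_iff.1 hk
  refine le_trans ?_ (abs_apply_le_norm (lattice k) i)
  rw [lattice_apply, ← Int.cast_abs]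
  exact_mod_cast Int.one_le_abs hi

theorem AdmissibleWeight.summable_exp {w : ℝ → ℝ} (hw : AdmissibleWeight w) (n : ℕ) {δ : ℝ}
    (hδ : 0 < δ) : Summable fun k : Fin n → ℤ => Real.exp (-(δ * w ‖(lattice k : E n)‖)) := by
  obtain ⟨r, hr, hs⟩ := exists_summable_norm_lattice n
  obtain ⟨T, hT⟩ := eventually_atTop.1
    -- With this multiple of the logarithm, `e^{-δ w(t)} ≤ t^r` for large `t`.
    (((hw.superlog (-r / δ)).eventually_ge_atTop 0).and (eventually_ge_atTop 1))
  set S := max T 1 with hS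
  have hS0 : 0 < S := by positivity
  -- The constant `S^(-r)` covers `1 ≤ t < S`. The origin must be discarded because `0^r = 0` in the
  -- majorant.
  refine Summable.of_norm_bounded_eventually (hs.mul_left (max 1 (S ^ (-r)))) ?_
  filter_upwards [(Set.finite_singleton (0 : Fin n → ℤ)).compl_mem_cofinite] with k hk
  have h1 := one_le_norm_lattice (n := n) hk
  set t := ‖(lattice k : E n)‖ with ht
  have ht0 : 0 < t := by linarith
  rw [Real.norm_eq_abs, Real.abs_exp]
  by_cases h : S ≤ t
  · have h2 := (hT t ((le_max_left _ _).trans h)).1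
    calc Real.exp (-(δ * w t)) ≤ Real.exp (Real.log t * r) := by
          rw [Real.exp_le_exp]
          have h3 : δ * (-r / δ * Real.log t) ≤ δ * w t := by
            gcongr
            linarith
          rw [show δ * (-r / δ * Real.log t) = -(Real.log t * r) by field_simp] at h3
          linarith
      _ = 1 * t ^ r := by rw [one_mul, Real.rpow_def_of_pos ht0]
      _ ≤ _ := by
          gcongr
          exact le_max_left _ _
  · have h2 : w t ≥ 1 := hw.one_le t ht0.le
    calc Real.exp (-(δ * w t)) ≤ 1 := by
          rw [Real.exp_le_one_iff]
          have : 0 ≤ δ * w t := by positivity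
          linarith
      _ = S ^ (-r) * S ^ r := by rw [← Real.rpow_add hS0]; simp
      _ ≤ S ^ (-r) * t ^ r := by
          gcongr ?_ * ?_
          exact Real.rpow_le_rpow_of_nonpos ht0 (not_le.1 h).le hr.le
      _ ≤ _ := by
          gcongr
          exact le_max_right _ _

/-! ### The weighted sequence algebra and products in modulation spaces -/

section Algebra

variable {n : ℕ}

/-- The weight `exp(w(|k|))`. -/
def expWeight (w : ℝ → ℝ) (k : Fin n → ℤ) : ℝ≥0∞ := ENNReal.ofReal (Real.exp (w ‖lattice k‖))

theorem AdmissibleWeight.tsum_exp_ne_top {w : ℝ → ℝ} (hw : AdmissibleWeight w) (n : ℕ) {δ : ℝ}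
    (hδ : 0 < δ) :
    ∑' k : Fin n → ℤ, ENNReal.ofReal (Real.exp (-(δ * w ‖(lattice k : E n)‖))) ≠ ⊤ :=
  (hw.summable_exp n hδ).tsum_ofReal_ne_top

theorem AdmissibleWeight.exists_expWeight_le {w : ℝ → ℝ} (hw : AdmissibleWeight w)
    (J : Finset (Fin n → ℤ)) :
    ∃ (K : ℝ≥0) (ε : (Fin n → ℤ) → ℝ≥0∞), ∑' k, ε k ≠ ⊤ ∧ ∀ l m, ∀ j ∈ J,
      expWeight w (l + m + j) ≤ K * (expWeight w l * expWeight w m) * (ε l + ε m) := by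
  obtain ⟨δ, K, hδ, hK⟩ := hw.exists_exp_le (D := ∑ j ∈ J, ‖(lattice j : E n)‖) (by positivity)
  refine ⟨⟨Real.exp K, (Real.exp_pos K).le⟩, _, hw.tsum_exp_ne_top n hδ, fun l m j hj => ?_⟩
  have h1 : ‖(lattice (l + m + j) : E n)‖ ≤
      ‖(lattice l : E n)‖ + ‖(lattice m : E n)‖ + ∑ j ∈ J, ‖(lattice j : E n)‖ := by
    rw [lattice_add, lattice_add]
    refine (norm_add₃_le).trans ?_
    gcongr
    exact Finset.single_le_sum (f := fun j => ‖(lattice j : E n)‖) (fun _ _ => norm_nonneg _) hj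
  have h2 := (Real.exp_le_exp.2 (hw.mono (norm_nonneg _) h1)).trans
    (hK _ _ (norm_nonneg (lattice l : E n)) (norm_nonneg (lattice m : E n)))
  refine (ENNReal.ofReal_le_ofReal h2).trans_eq ?_
  rw [ENNReal.ofReal_mul (by positivity), ENNReal.ofReal_mul (by positivity),
    ENNReal.ofReal_mul (by positivity), ENNReal.ofReal_add (by positivity) (by positivity)]
  congr 3
  exact ENNReal.ofReal_eq_coe_nnreal _

theorem tsum_mul_le_lqENorm {q : ℝ≥0∞} (hq : 1 ≤ q) (ε a : (Fin n → ℤ) → ℝ≥0∞) :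
    ∑' l, ε l * a l ≤ (∑' l, ε l) * lqENorm q a := by
  rw [← ENNReal.tsum_mul_right]
  refine ENNReal.tsum_le_tsum fun l => ?_
  gcongr
  exact le_lqENorm hq a l

/-- Weighted sequence spaces are convolution algebras. -/
theorem AdmissibleWeight.exists_lqENorm_le {w : ℝ → ℝ} (hw : AdmissibleWeight w)
    (J : Finset (Fin n → ℤ)) : ∃ C : ℝ≥0, ∀ q : ℝ≥0∞, 1 ≤ q → ∀ α β : (Fin n → ℤ) → ℝ≥0∞,
      lqENorm q (fun k => expWeight w k * ∑' l, ∑ j ∈ J, α l * β (k - l - j)) ≤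
        C * lqENorm q (fun k => expWeight w k * α k) *
          lqENorm q (fun k => expWeight w k * β k) := by
  obtain ⟨K, ε, hε, hK⟩ := hw.exists_expWeight_le J
  set S := ∑' k, ε k with hS
  refine ⟨J.card * (K * (2 * S.toNNReal)), fun q hq α β => ?_⟩
  set a := fun k => expWeight w k * α k with ha
  set b := fun k => expWeight w k * β k with hb
  -- The two sums correspond to the gain falling on the first or on the second factor. In each, `ε
  -- a` or `ε b` is in `ℓ^1` and the other sequence stays in `ℓ^q`.
  set c : (Fin n → ℤ) → ℝ≥0∞ := fun k =>
    ∑' l, (ε l * a l) * b (k - l) + ∑' l, (ε l * b l) * a (k - l) with hc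
  have h1 : lqENorm q c ≤ 2 * S * (lqENorm q a * lqENorm q b) := by
    refine (lqENorm_add_le hq _ _).trans ?_
    calc _ ≤ (S * lqENorm q a) * lqENorm q b + (S * lqENorm q b) * lqENorm q a := by
          refine add_le_add ((lqENorm_convolution_le hq _ _).trans ?_)
            ((lqENorm_convolution_le hq _ _).trans ?_)
          · gcongr
            exact tsum_mul_le_lqENorm hq ε a
          · gcongr
            exact tsum_mul_le_lqENorm hq ε b
      _ = _ := by ring
  have h2 : ∀ k, expWeight w k * ∑' l, ∑ j ∈ J, α l * β (k - l - j) ≤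
      ∑ j ∈ J, K * c (k - j) := fun k => by
    rw [Summable.tsum_finsetSum fun _ _ => ENNReal.summable, Finset.mul_sum]
    refine Finset.sum_le_sum fun j hj => ?_
    have h3 : ∑' l, a l * (ε (k - j - l) * b (k - j - l)) =
        ∑' l, (ε l * b l) * a (k - j - l) := by
      rw [← (Equiv.subLeft (k - j)).tsum_eq]
      refine tsum_congr fun l => ?_
      simp only [Equiv.subLeft_apply, sub_sub_cancel]
      ring
    simp only [hc]
    rw [← h3, ← ENNReal.tsum_add, ← ENNReal.tsum_mul_left, ← ENNReal.tsum_mul_left]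
    refine ENNReal.tsum_le_tsum fun l => ?_
    have h4 := hK l (k - l - j) j hj
    rw [show l + (k - l - j) + j = k by abel] at h4
    rw [show k - j - l = k - l - j by abel]
    calc _ ≤ K * (expWeight w l * expWeight w (k - l - j)) * (ε l + ε (k - l - j)) *
          (α l * β (k - l - j)) := by gcongr
      _ = _ := by
          simp only [ha, hb]
          ring
  calc _ ≤ lqENorm q (fun k => ∑ j ∈ J, K * c (k - j)) := lqENorm_mono h2
    _ ≤ ∑ j ∈ J, lqENorm q (fun k => K * c (k - j)) :=
        lqENorm_sum_le hq J fun j k => K * c (k - j)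
    _ = ∑ j ∈ J, K * lqENorm q c := by
        refine Finset.sum_congr rfl fun j _ => ?_
        rw [lqENorm_const_mul hq]
        congr 1
        exact lqENorm_comp_equiv c (Equiv.subRight j)
    _ ≤ ∑ j ∈ J, K * (2 * S * (lqENorm q a * lqENorm q b)) := by gcongr
    _ = _ := by
        rw [Finset.sum_const, nsmul_eq_mul]
        push_cast
        rw [ENNReal.coe_toNNReal hε]
        ring

variable {ρ : E n → ℝ} {w : ℝ → ℝ}

theorem IsWindow.modENorm_eq (hρ : IsWindow ρ) {p q : ℝ≥0∞} [Fact (1 ≤ p)]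
    (f : Lp ℂ p (volume : Measure (E n))) :
    modENorm ρ w p q f = lqENorm q fun k => expWeight w k * ‖hρ.boxLp p k f‖ₑ := by
  simp only [modENorm, hρ.distENorm_box, expWeight]

/-- `∑_k ‖□_k f‖_p` is controlled by the modulation space norm. -/
theorem IsWindow.exists_tsum_enorm_boxLp_le (hρ : IsWindow ρ) (hw : AdmissibleWeight w) :
    ∃ C : ℝ≥0, ∀ (p q : ℝ≥0∞) [Fact (1 ≤ p)], 1 ≤ q → ∀ f : Lp ℂ p (volume : Measure (E n)),
      ∑' k, ‖hρ.boxLp p k f‖ₑ ≤ C * modENorm ρ w p q f := by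
  have h1 := hw.tsum_exp_ne_top n one_pos
  refine ⟨(∑' k : Fin n → ℤ, ENNReal.ofReal (Real.exp (-(1 * w ‖(lattice k : E n)‖)))).toNNReal,
    fun p q _ hq f => ?_⟩
  rw [ENNReal.coe_toNNReal h1, hρ.modENorm_eq]
  refine le_trans (le_of_eq ?_) (tsum_mul_le_lqENorm hq _ _)
  refine tsum_congr fun k => ?_
  rw [← mul_assoc, expWeight, ← ENNReal.ofReal_mul (by positivity), ← Real.exp_add]
  simp

theorem enorm_holderL_le {p₁ p₂ p : ℝ≥0∞} [Fact (1 ≤ p₁)] [Fact (1 ≤ p₂)] [Fact (1 ≤ p)]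
    [p₁.HolderTriple p₂ p] (f : Lp ℂ p₁ (volume : Measure (E n)))
    (g : Lp ℂ p₂ (volume : Measure (E n))) :
    ‖(ContinuousLinearMap.mul ℂ ℂ).holderL volume p₁ p₂ p f g‖ₑ ≤ ‖f‖ₑ * ‖g‖ₑ := by
  have h := ContinuousLinearMap.nnnorm_holder_apply_apply_le (r := p)
    (ContinuousLinearMap.mul ℂ ℂ) f g
  have h1 : ‖ContinuousLinearMap.mul ℂ ℂ‖₊ = 1 := by
    ext
    simp
  rw [h1, one_mul] at h
  simp only [enorm_eq_nnnorm]
  exact_mod_cast h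

/-- Expand `f` and `g` into their pieces inside the continuous bilinear Hölder map. For given `k`
and `l`, only the pieces of `g` at `k - l - j` with `j` in a fixed cube contribute. -/
theorem IsWindow.enorm_boxLp_holderL_le (hρ : IsWindow ρ) {p₁ p₂ p : ℝ≥0∞} [Fact (1 ≤ p₁)]
    [Fact (1 ≤ p₂)] [Fact (1 ≤ p)] [p₁.HolderTriple p₂ p]
    {f : Lp ℂ p₁ (volume : Measure (E n))} {g : Lp ℂ p₂ (volume : Measure (E n))}
    (hf : ∑' k, ‖hρ.boxLp p₁ k f‖ₑ ≠ ⊤) (hg : ∑' k, ‖hρ.boxLp p₂ k g‖ₑ ≠ ⊤) (k : Fin n → ℤ) :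
    ‖hρ.boxLp p k ((ContinuousLinearMap.mul ℂ ℂ).holderL volume p₁ p₂ p f g)‖ₑ ≤
      hρ.bound * ∑' l, ∑ j ∈ cubePoints (0 : E n) 3,
        ‖hρ.boxLp p₁ l f‖ₑ * ‖hρ.boxLp p₂ (k - l - j) g‖ₑ := by
  set B := (ContinuousLinearMap.mul ℂ ℂ).holderL (volume : Measure (E n)) p₁ p₂ p with hB
  have h1 := ((hρ.hasSum_boxLp f hf).mapL (B.flip g)).mapL (hρ.boxLp p k)
  refine (enorm_le_tsum_enorm_of_hasSum h1).trans ?_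
  rw [← ENNReal.tsum_mul_left]
  refine ENNReal.tsum_le_tsum fun l => ?_
  have h2 := ((hρ.hasSum_boxLp g hg).mapL (B (hρ.boxLp p₁ l f))).mapL (hρ.boxLp p k)
  refine (enorm_le_tsum_enorm_of_hasSum h2).trans ?_
  rw [← (Equiv.subLeft (k - l)).tsum_eq]
  simp only [Equiv.subLeft_apply]
  rw [_root_.tsum_eq_sum (s := cubePoints (0 : E n) 3), Finset.mul_sum]
  · refine Finset.sum_le_sum fun j _ => ?_
    refine (hρ.enorm_boxLp_le k _).trans ?_
    gcongr
    exact enorm_holderL_le _ _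
  · intro j hj
    rw [enorm_eq_zero]
    refine toTemperedDistribution_injective ?_
    simp only
    rw [toTemperedDistribution_zero, hρ.toTemperedDistribution_boxLp]
    refine hρ.box_mul_eq_zero (l := l) (m := k - l - j) (by rwa [sub_sub_cancel]) f g ?_
    exact ContinuousLinearMap.coeFn_holder (r := p) (ContinuousLinearMap.mul ℂ ℂ) _ _

theorem IsWindow.exists_mul_mem (hρ : IsWindow ρ) (hw : AdmissibleWeight w) (q : ℝ≥0∞)
    [hq : Fact (1 ≤ q)] :
    ∃ C : ℝ≥0, ∀ (p₁ p₂ p : ℝ≥0∞) [Fact (1 ≤ p₁)] [Fact (1 ≤ p₂)] [Fact (1 ≤ p)],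
      p⁻¹ = p₁⁻¹ + p₂⁻¹ →
      ∀ f ∈ modulationSpace ρ w p₁ q, ∀ g ∈ modulationSpace ρ w p₂ q,
        ∃ h ∈ modulationSpace ρ w p q, (h =ᵐ[volume] fun x => f x * g x) ∧
          modENorm ρ w p q h ≤ C * modENorm ρ w p₁ q f * modENorm ρ w p₂ q g := by
  obtain ⟨C₁, hC₁⟩ := hρ.exists_tsum_enorm_boxLp_le hw
  obtain ⟨C₂, hC₂⟩ := hw.exists_lqENorm_le (cubePoints (0 : E n) 3)
  refine ⟨hρ.bound * C₂, fun p₁ p₂ p _ _ _ hp f hf g hg => ?_⟩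
  have hf' : modENorm ρ w p₁ q f < ⊤ := hf
  have hg' : modENorm ρ w p₂ q g < ⊤ := hg
  have : p₁.HolderTriple p₂ p := ⟨hp.symm⟩
  set h := (ContinuousLinearMap.mul ℂ ℂ).holderL (volume : Measure (E n)) p₁ p₂ p f g with hh
  have key : modENorm ρ w p q h ≤
      (hρ.bound * C₂ : ℝ≥0) * modENorm ρ w p₁ q f * modENorm ρ w p₂ q g := by
    have h1 := fun k => hρ.enorm_boxLp_holderL_le (p := p)
      ((hC₁ p₁ q hq.out f).trans_lt (ENNReal.mul_lt_top ENNReal.coe_lt_top hf')).ne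
      ((hC₁ p₂ q hq.out g).trans_lt (ENNReal.mul_lt_top ENNReal.coe_lt_top hg')).ne k
    have h2 := hC₂ q hq.out (fun k => ‖hρ.boxLp p₁ k f‖ₑ) (fun k => ‖hρ.boxLp p₂ k g‖ₑ)
    rw [← hρ.modENorm_eq, ← hρ.modENorm_eq] at h2
    rw [hρ.modENorm_eq]
    calc _ ≤ lqENorm q fun k => (hρ.bound : ℝ≥0∞) * (expWeight w k * ∑' l,
          ∑ j ∈ cubePoints (0 : E n) 3, ‖hρ.boxLp p₁ l f‖ₑ * ‖hρ.boxLp p₂ (k - l - j) g‖ₑ) := by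
          refine lqENorm_mono fun k => ?_
          rw [mul_left_comm]
          gcongr
          exact h1 k
      _ ≤ hρ.bound * (C₂ * modENorm ρ w p₁ q f * modENorm ρ w p₂ q g) := by
          rw [lqENorm_const_mul hq.out]
          gcongr
      _ = _ := by
          push_cast
          ring
  refine ⟨h, key.trans_lt
    (ENNReal.mul_lt_top (ENNReal.mul_lt_top ENNReal.coe_lt_top hf') hg'), ?_, key⟩
  exact ContinuousLinearMap.coeFn_holder (r := p) (ContinuousLinearMap.mul ℂ ℂ) f g

/-- The embedding of `ℳ_{p,q}` into `ℳ_{∞,q}`. -/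
theorem IsWindow.exists_ae_eq_modENorm_top_le (hρ : IsWindow ρ) (hw : AdmissibleWeight w)
    {p q : ℝ≥0∞} [Fact (1 ≤ p)] [hq : Fact (1 ≤ q)] {f : Lp ℂ p (volume : Measure (E n))}
    (hf : f ∈ modulationSpace ρ w p q) :
    ∃ F ∈ modulationSpace ρ w ⊤ q, F =ᵐ[volume] f ∧
      modENorm ρ w ⊤ q F ≤ (5 ^ n * hρ.bound : ℝ≥0) * modENorm ρ w p q f := by
  obtain ⟨C₁, hC₁⟩ := hρ.exists_tsum_enorm_boxLp_le hw
  have hf' : modENorm ρ w p q f < ⊤ := hf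
  have hsum : ∑' k, ‖hρ.boxLp p k f‖ₑ ≠ ⊤ :=
    ((hC₁ p q hq.out f).trans_lt (ENNReal.mul_lt_top ENNReal.coe_lt_top hf')).ne
  choose F hF hFle using fun k => hρ.exists_lp_top_box k f
  have hs : Summable F := by
    refine summable_of_tsum_enorm_ne_top (ne_top_of_le_ne_top ?_ (ENNReal.tsum_le_tsum hFle))
    rw [ENNReal.tsum_mul_left]
    finiteness
  obtain ⟨G, hG⟩ := hs
  have h1 := hG.mapL (Lp.toTemperedDistributionCLM ℂ (volume : Measure (E n)) ⊤)
  have h2 := (hρ.hasSum_boxLp f hsum).mapL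
    (Lp.toTemperedDistributionCLM ℂ (volume : Measure (E n)) p)
  simp only [Lp.toTemperedDistributionCLM_apply, hF] at h1
  simp only [Lp.toTemperedDistributionCLM_apply, hρ.toTemperedDistribution_boxLp] at h2
  have h3 : Lp.toTemperedDistribution G = Lp.toTemperedDistribution f := h1.unique h2
  have key : modENorm ρ w ⊤ q G ≤ (5 ^ n * hρ.bound : ℝ≥0) * modENorm ρ w p q f := by
    -- As `G` and `f` are the same distribution, each `□_k G` is represented by the Bernstein
    -- function `F k`, so the norms compare term by term.
    rw [modENorm, h3, hρ.modENorm_eq, ← lqENorm_const_mul hq.out]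
    refine lqENorm_mono fun k => ?_
    rw [mul_left_comm]
    gcongr
    · exact le_rfl
    · rw [← hF, distENorm_toTemperedDistribution]
      refine (hFle k).trans_eq ?_
      push_cast
      rfl
  exact ⟨G, key.trans_lt (ENNReal.mul_lt_top ENNReal.coe_lt_top hf'),
    ae_eq_of_toTemperedDistribution_eq h3, key⟩

theorem IsWindow.exists_mul_self_mem (hρ : IsWindow ρ) (hw : AdmissibleWeight w) (q : ℝ≥0∞)
    [hq : Fact (1 ≤ q)] :
    ∃ C : ℝ≥0, ∀ (p : ℝ≥0∞) [Fact (1 ≤ p)],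
      ∀ f ∈ modulationSpace ρ w p q, ∀ g ∈ modulationSpace ρ w p q,
        ∃ h ∈ modulationSpace ρ w p q, (h =ᵐ[volume] fun x => f x * g x) ∧
          modENorm ρ w p q h ≤ C * modENorm ρ w p q f * modENorm ρ w p q g := by
  obtain ⟨C, hC⟩ := hρ.exists_mul_mem hw q
  refine ⟨C * (5 ^ n * hρ.bound), fun p _ f hf g hg => ?_⟩
  obtain ⟨G, hG, hGg, hGle⟩ := hρ.exists_ae_eq_modENorm_top_le hw hg
  -- One factor is moved to `ℳ_{∞,q}`, and the Hölder case applies with exponents `p, ∞, p`.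
  obtain ⟨h, hh, hfg, hle⟩ := hC p ⊤ p (by simp) f hf G hG
  refine ⟨h, hh, ?_, hle.trans ?_⟩
  · filter_upwards [hfg, hGg] with x h1 h2
    rw [h1, h2]
  · calc _ ≤ C * modENorm ρ w p q f * ((5 ^ n * hρ.bound : ℝ≥0) * modENorm ρ w p q g) := by gcongr
      _ = _ := by
        push_cast
        ring

/-! ### Superposition -/

/-- Countable Minkowski inequality in modulation spaces. -/
theorem IsWindow.modENorm_le_tsum (hρ : IsWindow ρ) {p q : ℝ≥0∞} [Fact (1 ≤ p)] (hq : 1 ≤ q)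
    {f : ℕ → Lp ℂ p (volume : Measure (E n))} {h : Lp ℂ p (volume : Measure (E n))}
    (hf : HasSum f h) : modENorm ρ w p q h ≤ ∑' m, modENorm ρ w p q (f m) := by
  simp only [hρ.modENorm_eq]
  refine (lqENorm_mono fun k => ?_).trans (lqENorm_tsum_le hq _)
  rw [ENNReal.tsum_mul_left]
  gcongr
  exact enorm_le_tsum_enorm_of_hasSum (hf.mapL (hρ.boxLp p k))

theorem IsWindow.enorm_le_tsum_enorm_boxLp (hρ : IsWindow ρ) {p : ℝ≥0∞} [Fact (1 ≤ p)]
    (f : Lp ℂ p (volume : Measure (E n))) : ‖f‖ₑ ≤ ∑' k, ‖hρ.boxLp p k f‖ₑ := by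
  by_cases hf : ∑' k, ‖hρ.boxLp p k f‖ₑ = ⊤
  · rw [hf]
    exact le_top
  · exact enorm_le_tsum_enorm_of_hasSum (hρ.hasSum_boxLp f hf)

theorem IsWindow.summable_of_tsum_modENorm_ne_top (hρ : IsWindow ρ) (hw : AdmissibleWeight w)
    {p q : ℝ≥0∞} [Fact (1 ≤ p)] [hq : Fact (1 ≤ q)] {f : ℕ → Lp ℂ p (volume : Measure (E n))}
    (hf : ∑' m, modENorm ρ w p q (f m) ≠ ⊤) : Summable f := by
  obtain ⟨C₁, hC₁⟩ := hρ.exists_tsum_enorm_boxLp_le hw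
  have h4 : ∑' m, ‖f m‖ₑ ≤ C₁ * ∑' m, modENorm ρ w p q (f m) := by
    rw [← ENNReal.tsum_mul_left]
    exact ENNReal.tsum_le_tsum fun m =>
      (hρ.enorm_le_tsum_enorm_boxLp (f m)).trans (hC₁ p q hq.out (f m))
  exact summable_of_tsum_enorm_ne_top (ne_top_of_le_ne_top
    (ENNReal.mul_ne_top ENNReal.coe_ne_top hf) h4)

/-- Convergence in `L^p` gives convergence in measure, so some subsequence of partial sums converges
almost everywhere; its limit must be the pointwise sum. -/
theorem ae_eq_of_hasSum {p : ℝ≥0∞} [hp : Fact (1 ≤ p)]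
    {f : ℕ → Lp ℂ p (volume : Measure (E n))} {h : Lp ℂ p (volume : Measure (E n))}
    (hf : HasSum f h) {u : ℕ → E n → ℂ} {v : E n → ℂ} (hu : ∀ m, f m =ᵐ[volume] u m)
    (huv : ∀ x, HasSum (fun m => u m x) (v x)) : h =ᵐ[volume] v := by
  have h1 : ∀ N : ℕ, ∀ᵐ x, (∑ m ∈ Finset.range N, f m : Lp ℂ p (volume : Measure (E n))) x =
      ∑ m ∈ Finset.range N, u m x := fun N => by
    induction N with
    | zero =>
      simp
    | succ N ih =>
      rw [Finset.sum_range_succ]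
      filter_upwards [ih, hu N, Lp.coeFn_add (∑ m ∈ Finset.range N, f m) (f N)] with x h1 h2 h3
      rw [h3, Pi.add_apply, h1, h2, Finset.sum_range_succ]
  have h2 := tendstoInMeasure_of_tendsto_Lp hf.tendsto_sum_nat
  obtain ⟨ns, hns, h3⟩ := h2.exists_seq_tendsto_ae
  filter_upwards [h3, ae_all_iff.2 h1] with x hx1 hx2
  refine tendsto_nhds_unique hx1 ?_
  simp only [hx2]
  exact (huv x).tendsto_sum_nat.comp hns.tendsto_atTop

theorem IsWindow.exists_pow_mem (hρ : IsWindow ρ) (hw : AdmissibleWeight w) {p q : ℝ≥0∞}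
    [Fact (1 ≤ p)] [hq : Fact (1 ≤ q)] {f : Lp ℂ p (volume : Measure (E n))}
    (hf : f ∈ modulationSpace ρ w p q) :
    ∃ R : ℝ≥0, ∀ m : ℕ, ∃ g ∈ modulationSpace ρ w p q,
      (g =ᵐ[volume] fun x => f x ^ (m + 1)) ∧ modENorm ρ w p q g ≤ (R : ℝ≥0∞) ^ (m + 1) := by
  obtain ⟨C, hC⟩ := hρ.exists_mul_self_mem hw q
  have hf' : modENorm ρ w p q f < ⊤ := hf
  obtain ⟨x, hx⟩ : ∃ x : ℝ≥0, (x : ℝ≥0∞) = modENorm ρ w p q f :=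
    ⟨_, ENNReal.coe_toNNReal hf'.ne⟩
  -- The `1` serves the base case, the `C` each further multiplication by `f`.
  refine ⟨(1 + C) * x, fun m => ?_⟩
  induction m with
  | zero =>
    refine ⟨f, hf, by simp, ?_⟩
    rw [← hx, zero_add, pow_one]
    norm_cast
    exact le_mul_of_one_le_left zero_le (by simp)
  | succ m ih =>
    obtain ⟨g, hg, hgf, hgle⟩ := ih
    obtain ⟨h, hh, hfg, hle⟩ := hC p f hf g hg
    refine ⟨h, hh, ?_, hle.trans ?_⟩
    · filter_upwards [hgf, hfg] with y h1 h2
      rw [h2, h1, pow_succ' _ (m + 1)]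
    · rw [pow_succ' _ (m + 1)]
      gcongr
      rw [← hx]
      norm_cast
      gcongr
      simp

theorem IsWindow.exists_comp_mem (hρ : IsWindow ρ) (hw : AdmissibleWeight w) {p q : ℝ≥0∞}
    [Fact (1 ≤ p)] [hq : Fact (1 ≤ q)] {F : ℂ → ℂ} (hF : Differentiable ℂ F) (hF0 : F 0 = 0)
    {f : Lp ℂ p (volume : Measure (E n))} (hf : f ∈ modulationSpace ρ w p q) :
    ∃ h ∈ modulationSpace ρ w p q, h =ᵐ[volume] fun x => F (f x) := by
  obtain ⟨R, hR⟩ := hρ.exists_pow_mem hw hf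
  choose g hg hgf hgle using hR
  obtain ⟨a, ha⟩ : ∃ a : ℕ → ℂ, ∀ z, HasSum (fun m => a m * z ^ m) (F z) := by
    refine ⟨fun m => (m.factorial : ℂ)⁻¹ * iteratedDeriv m F 0, fun z => ?_⟩
    have := Complex.hasSum_taylorSeries_of_entire hF 0 z
    simp only [sub_zero, smul_eq_mul] at this
    exact this.congr_fun fun m => by ring
  have ha' : ∀ z, HasSum (fun m => a (m + 1) * z ^ (m + 1)) (F z) := fun z => by
    -- The constant term has to vanish: the bounds for powers of `f` begin with the first power.
    have h0 : a 0 = 0 := by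
      have h1 := ha 0
      rw [hF0] at h1
      have h2 : HasSum (fun m => a m * (0 : ℂ) ^ m) (a 0 * 0 ^ 0) :=
        hasSum_single 0 fun m hm => by simp [hm]
      simpa using h2.unique h1
    rw [hasSum_nat_add_iff (f := fun m => a m * z ^ m) 1]
    simpa [h0] using ha z
  have hfin : ∑' m, modENorm ρ w p q (a (m + 1) • g m) ≠ ⊤ := by
    -- Evaluating the everywhere convergent series at the growth rate `R` yields a summable majorant
    -- of the norms.
    have h1 := (ha' (R : ℂ)).summable.norm
    have h2 := h1.tsum_ofReal_ne_top
    refine ne_top_of_le_ne_top h2 (ENNReal.tsum_le_tsum fun m => ?_)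
    refine (modENorm_smul_le ρ w p q hq.out _ _).trans ?_
    calc _ ≤ ‖a (m + 1)‖ₑ * (R : ℝ≥0∞) ^ (m + 1) := by
          gcongr
          exact hgle m
      _ = _ := by
          rw [ofReal_norm, enorm_mul, enorm_pow]
          congr 2
          rw [enorm_eq_nnnorm]
          congr 1
          ext
          simp
  obtain ⟨h, hh⟩ := hρ.summable_of_tsum_modENorm_ne_top hw hfin
  refine ⟨h, (hρ.modENorm_le_tsum hq.out hh).trans_lt hfin.lt_top, ?_⟩
  refine ae_eq_of_hasSum hh (u := fun m x => a (m + 1) * f x ^ (m + 1)) (fun m => ?_) fun x => ha' _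
  filter_upwards [hgf m, Lp.coeFn_smul (a (m + 1)) (g m)] with x h1 h2
  rw [h2, Pi.smul_apply, h1, smul_eq_mul]

end Algebra

end ModSpace

end

theorem mainTheorem1 (n : ℕ) (ρ : ModSpace.E n → ℝ) (hρ : ModSpace.IsWindow ρ)
    (w : ℝ → ℝ) (hw : ModSpace.AdmissibleWeight w) (q : ℝ≥0∞) [Fact (1 ≤ q)] :
    -- the product estimate and the algebra property; the constant depends on `n, ρ, w, q` only
    (∃ C : ℝ≥0, 0 < C ∧
      (∀ (p₁ p₂ p : ℝ≥0∞) [Fact (1 ≤ p₁)] [Fact (1 ≤ p₂)] [Fact (1 ≤ p)],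
        p⁻¹ = p₁⁻¹ + p₂⁻¹ →
        ∀ f ∈ ModSpace.modulationSpace ρ w p₁ q, ∀ g ∈ ModSpace.modulationSpace ρ w p₂ q,
          ∃ h ∈ ModSpace.modulationSpace ρ w p q,
            (h =ᵐ[volume] fun x => f x * g x) ∧
            ModSpace.modENorm ρ w p q h ≤
              C * ModSpace.modENorm ρ w p₁ q f * ModSpace.modENorm ρ w p₂ q g) ∧
      (∀ (p : ℝ≥0∞) [Fact (1 ≤ p)],
        ∀ f ∈ ModSpace.modulationSpace ρ w p q, ∀ g ∈ ModSpace.modulationSpace ρ w p q,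
          ∃ h ∈ ModSpace.modulationSpace ρ w p q,
            (h =ᵐ[volume] fun x => f x * g x) ∧
            ModSpace.modENorm ρ w p q h ≤
              C * ModSpace.modENorm ρ w p q f * ModSpace.modENorm ρ w p q g)) ∧
    -- superposition with entire functions vanishing at the origin
    (∀ (p : ℝ≥0∞) [Fact (1 ≤ p)] (F : ℂ → ℂ), Differentiable ℂ F → F 0 = 0 →
      ∀ f ∈ ModSpace.modulationSpace ρ w p q,
        ∃ h ∈ ModSpace.modulationSpace ρ w p q, h =ᵐ[volume] fun x => F (f x)) := by
  obtain ⟨C₁, hC₁⟩ := hρ.exists_mul_mem hw q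
  obtain ⟨C₂, hC₂⟩ := hρ.exists_mul_self_mem hw q
  -- The sum dominates both constants; the `1` makes it positive.
  refine ⟨⟨C₁ + C₂ + 1, by positivity, fun p₁ p₂ p _ _ _ hp f hf g hg => ?_,
    fun p _ f hf g hg => ?_⟩, fun p _ F hF hF0 f hf => hρ.exists_comp_mem hw hF hF0 hf⟩
  · obtain ⟨h, hh, hfg, hle⟩ := hC₁ p₁ p₂ p hp f hf g hg
    refine ⟨h, hh, hfg, hle.trans ?_⟩
    gcongr
    exact le_add_right (le_add_right le_rfl)
  · obtain ⟨h, hh, hfg, hle⟩ := hC₂ p f hf g hg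
    refine ⟨h, hh, hfg, hle.trans ?_⟩
    gcongr
    exact le_add_right (le_add_left le_rfl)
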